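/- Let $D\ge 3$ be odd and let $0\le d\le 2D$ be an integer. Let $S=\{1,\dots,2D\}$. The folded cube $\square_{2D}$ is the graph whose vertices are the unordered pairs $z=\{z_1,z_2\}$ of complementary subsets of $S$, where $z,w$ are adjacent when $\min_{a,b\in\{1,2\}}|z_a\triangle w_b|=1$. Let $\partial$ be its path-length distance, and let $A(\square_{2D},d)$ be the maximum size of a nonempty set $C$ of vertices such that $\partial(x,y)\ge d$ for all distinct $x,y\in C$. Let $\mathcal I$ be the set of integer triples $(i,j,t)$ with $0\le t\le i,j\le D$, $i+j-t\le 2D-2$, with $t\ge\lfloor\frac{j+1}{2}\rfloor$ if $i=D$, and with $t\ge\lfloor\frac{i+1}{2}\rfloor$ if $j=D$. Put $\binom ab=0$ unless $0\le b\le a$. Put $\tau_{i,j,t}=\frac12$ if ($i=D$ and $2t=j$) or ($j=D$ and $2t=i$), and $\tau_{i,j,t}=1$ otherwise. For $(i,j,t)\in\mathcal I$ and $0\le r\le \min\{i,j,D-1\}$, with $r$ even if $i=D$ or $j=D$, define $\beta^r_{i,j,t}$ as follows. * For $i,j\le D-1$: $$\beta^r_{i,j,t}=\binom{2D-2r}{i-r}\sum_{l=0}^{D-1}(-1)^{r-l}\binom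 rl\binom{i-l}{t-l}\binom{2D-i-r+l}{j-r-t+l}.$$ * For $i=D$, $j\le D-1$: $$\beta^r_{D,j,t}=2\tau_{D,j,t}\binom{2D-2r}{D-r}\Big(\sum_{l=\frac r2+1}^{D-1}(-1)^{r-l}\binom rl\Big[\binom{D-l}{t-l}\binom{D-r+l}{j-t-r+l}+\binom{D-r+l}{t-r+l}\binom{D-l}{j-t-l}\Big]+(-1)^{\frac r2}\binom r{r/2}\binom{D-\frac r2}{t-\frac r2}\binom{D-\frac r2}{j-t-\frac r2}\Big).$$ * For $i\le D-1$, $j=D$: $$\beta^r_{i,D,t}=\tau_{i,D,t}\binom{2D-2r}{i-r}\sum_{l=0}^{D-1}(-1)^{r-l}\binom rl\Big[\binom{i-l}{t-l}\binom{2D-r-i+l}{D-r-t+l}+\binom{i-l}{t}\binom{2D-r-i+l}{D-t}\Big].$$ * For $i=j=D$: $$\beta^r_{D,D,t}=2\binom{2D-2r}{D-r}\Big(\sum_{l=\frac r2+1}^{D-1}(-1)^{r-l}\binom rl\Big[\binom{D-l}{t-l}\binom{D-r+l}{t}+\binom{D-l}{t}\binom{D-r+l}{D-t}\Big]+(-1)^{\frac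 r2}\binom r{r/2}\binom{D-\frac r2}{D-t}\binom{D-\frac r2}{t}\Big).$$ Consider the semidefinite program in real variables $x^t_{i,j}$, $(i,j,t)\in\mathcal I$: maximize $$\sum_{i=0}^{D-1}\binom{2D}{i}x^0_{i,0}+\frac12\binom{2D}{D}x^0_{D,0}$$ subject to the following constraints, for all $(i,j,t),(i',j',t')\in\mathcal I$: 1. $x^0_{0,0}=1$; 2. $0\le x^t_{i,j}\le x^0_{i,0}$; 3. if $0\le i+j-2t\le D$ and $(i',j',i'+j'-2t')$ is a permutation of $(i,j,i+j-2t)$, then $x^t_{i,j}=x^{t'}_{i',j'}$; 4. if $D+1\le i+j-2t\le 2D-2$ and $(i',j',2D-(i'+j'-2t'))$ is a permutation of $(i,j,2D-(i+j-2t))$, then $x^t_{i,j}=x^{t'}_{i',j'}$; 5. $x^t_{i,j}=0$ if $\{i,j,i+j-2t,2D-(i+j-2t)\}\cap\{1,\dots,d-1\}\ne\emptyset$; 6. for each even $r$ with $0\le r\le D-1$, the matrices $$\Big(\sum_t\beta^r_{i,j,t}x^t_{i,j}\Big)_{i,j=r}^{D}\quad\text{and}\quad \Big(\sum_t\beta^r_{i,j,t}\,(x^0_{\zeta,0}-x^t_{i,j})\Big)_{i,j=r}^{D}$$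 are positive semidefinite, and for each odd $r$ with $1\le r\le D-2$, the matrices $$\Big(\sum_t\beta^r_{i,j,t}x^t_{i,j}\Big)_{i,j=r}^{D-1}\quad\text{and}\quad \Big(\sum_t\beta^r_{i,j,t}\,(x^0_{\zeta,0}-x^t_{i,j})\Big)_{i,j=r}^{D-1}$$ are positive semidefinite. Here the sums run over all $t$ with $(i,j,t)\in\mathcal I$, and $\zeta=\min\{i+j-2t,\,2D-(i+j-2t)\}$. Then this program attains its maximum, and the maximum is an upper bound on $A(\square_{2D},d)$. -/

import Mathlib

namespace FoldedCube

open Finset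
open scoped symmDiff

/-- Vertices of the folded `n`-cube: the unordered pairs `{u, uᶜ}` of complementary subsets of
an `n`-element set. -/
abbrev Vertex (n : ℕ) : Type :=
  {p : Sym2 (Finset (Fin n)) // ∃ u : Finset (Fin n), p = s(u, uᶜ)}

/-- The folded `n`-cube: distinct vertices `z`, `w` are adjacent when some member of `z` and some
member of `w` differ in exactly one element (that is, when the minimum of `|z_i ∆ w_j|` is `1`;
this minimum is `0` exactly when `z = w`). -/
def graph (n : ℕ) : SimpleGraph (Vertex n) where
  Adj z w := z ≠ w ∧ ∃ u ∈ z.1, ∃ v ∈ w.1, (u ∆ v).card = 1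
  symm := ⟨by
    rintro z w ⟨hne, u, hu, v, hv, h⟩
    exact ⟨hne.symm, v, hv, u, hu, by rwa [symmDiff_comm]⟩⟩
  loopless := ⟨fun _ h => h.1 rfl⟩

/-- A code (nonempty set of vertices) of `G` with minimum distance at least `d`, with respect to
the path-length distance of `G`. -/
def IsCode {V : Type*} (G : SimpleGraph V) (d : ℕ) (C : Finset V) : Prop :=
  C.Nonempty ∧ ∀ x ∈ C, ∀ y ∈ C, x ≠ y → d ≤ G.dist x y

/-- `A(G, d)`: the maximum size of a code of the finite graph `G` with minimum distance at
least `d`. -/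
noncomputable def codeNumber {V : Type*} [Finite V] (G : SimpleGraph V) (d : ℕ) : ℕ :=
  sSup {m : ℕ | ∃ C : Finset V, IsCode G d C ∧ C.card = m}

/-- The index set `𝓘` of the variables: the triples `(i, j, t)` with `0 ≤ t ≤ i, j ≤ D`,
`i + j - t ≤ 2D - 2`, with `t ≥ ⌊(j+1)/2⌋` if `i = D` and `t ≥ ⌊(i+1)/2⌋` if `j = D`. -/
def index (D : ℕ) : Finset (ℕ × ℕ × ℕ) :=
  (range (D + 1) ×ˢ range (D + 1) ×ˢ range (D + 1)).filter fun p =>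
    p.2.2 ≤ p.1 ∧ p.2.2 ≤ p.2.1 ∧ p.1 + p.2.1 + 2 ≤ 2 * D + p.2.2 ∧
    (p.1 = D → (p.2.1 + 1) / 2 ≤ p.2.2) ∧ (p.2.1 = D → (p.1 + 1) / 2 ≤ p.2.2)

/-- A choice of real values of the variables `x^t_{i,j}`, `(i, j, t) ∈ 𝓘`. -/
abbrev Variables (D : ℕ) : Type := index D → ℝ

/-- The variable `x^t_{i,j}`; it is only used for `(i, j, t) ∈ 𝓘`. -/
noncomputable def Variables.val {D : ℕ} (x : Variables D) (i j t : ℕ) : ℝ :=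
  if h : (i, j, t) ∈ index D then x ⟨(i, j, t), h⟩ else 0

/-- The binomial coefficient of two integers, equal to `0` unless `0 ≤ b ≤ a`. -/
def binom (a b : ℤ) : ℤ :=
  if 0 ≤ b ∧ b ≤ a then ((a.toNat.choose b.toNat : ℕ) : ℤ) else 0

/-- The sign and binomial coefficient `(-1)^(r-l) * (r choose l)`, which is `0` for `l > r`. -/
def signedChoose (r l : ℕ) : ℤ := (-1) ^ (r - l) * ((r.choose l : ℕ) : ℤ)

/-- The factor `1/2` for the triples with a tie, where the two members of a vertex `{y, yᶜ}` with
`|y| = D` meet a set of size `i` (or `j`) in equally many elements. -/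
noncomputable def tie (D i j t : ℕ) : ℝ :=
  if (i = D ∧ 2 * t = j) ∨ (j = D ∧ 2 * t = i) then 1 / 2 else 1

/-- `β^r_{i,j,t}` for `i, j ≤ D - 1`. -/
def betaInner (D r i j t : ℕ) : ℤ :=
  binom (2 * D - 2 * r) (i - r) *
    ∑ l ∈ range D, signedChoose r l * binom (i - l) (t - l) * binom (2 * D - i - r + l) (j - r - t + l)

/-- `β^r_{D,j,t}` for `j ≤ D - 1` and even `r`, before the tie factor. -/
def betaRow (D r j t : ℕ) : ℤ :=
  2 * binom (2 * D - 2 * r) (D - r) *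
    ((∑ l ∈ Ico (r / 2 + 1) D, signedChoose r l *
        (binom (D - l) (t - l) * binom (D - r + l) (j - t - r + l) +
          binom (D - r + l) (t - r + l) * binom (D - l) (j - t - l))) +
      binom (D - (r / 2 : ℕ)) (t - (r / 2 : ℕ)) * binom (D - (r / 2 : ℕ)) (j - t - (r / 2 : ℕ)) *
        signedChoose r (r / 2))

/-- `β^r_{i,D,t}` for `i ≤ D - 1` and even `r`, before the tie factor. -/
def betaCol (D r i t : ℕ) : ℤ :=
  binom (2 * D - 2 * r) (i - r) *
    ∑ l ∈ range D, signedChoose r l *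
      (binom (i - l) (t - l) * binom (2 * D - r - i + l) (D - r - t + l) +
        binom (i - l) t * binom (2 * D - r - i + l) (D - t))

/-- `β^r_{D,D,t}` for even `r ≤ D - 1`, before the tie factor. -/
def betaCorner (D r t : ℕ) : ℤ :=
  2 * binom (2 * D - 2 * r) (D - r) *
    ((∑ l ∈ Ico (r / 2 + 1) D, signedChoose r l *
        (binom (D - l) (t - l) * binom (D - r + l) t +
          binom (D - l) t * binom (D - r + l) (D - t))) +
      signedChoose r (r / 2) * binom (D - (r / 2 : ℕ)) (D - t) * binom (D - (r / 2 : ℕ)) t)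

/-- The coefficients `β^r_{i,j,t}` of the block-diagonalized matrices `M^t_{i,j}`, for
`0 ≤ r ≤ D - 1`, where `r` is even if `i = D` or `j = D`. -/
noncomputable def beta (D r i j t : ℕ) : ℝ :=
  if i < D then
    if j < D then (betaInner D r i j t : ℝ) else tie D i j t * (betaCol D r i t : ℝ)
  else
    if j < D then tie D i j t * (betaRow D r j t : ℝ) else tie D i j t * (betaCorner D r t : ℝ)

/-- `ζ = min {i + j - 2t, 2D - (i + j - 2t)}`. -/
def zeta (D i j t : ℕ) : ℕ := min (i + j - 2 * t) (2 * D - (i + j - 2 * t))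

/-- The `t` with `(i, j, t) ∈ 𝓘`. -/
def admissible (D i j : ℕ) : Finset ℕ := (range (D + 1)).filter fun t => (i, j, t) ∈ index D

/-- The matrix `(∑_t β^r_{i,j,t} x^t_{i,j})_{i,j=r}^{m}`. -/
noncomputable def block (D r m : ℕ) (x : Variables D) : Matrix (Icc r m) (Icc r m) ℝ :=
  Matrix.of fun i j => ∑ t ∈ admissible D i j, beta D r i j t * x.val i j t

/-- The matrix `(∑_t β^r_{i,j,t} (x^0_{ζ,0} - x^t_{i,j}))_{i,j=r}^{m}`. -/
noncomputable def coblock (D r m : ℕ) (x : Variables D) : Matrix (Icc r m) (Icc r m) ℝ :=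
  Matrix.of fun i j =>
    ∑ t ∈ admissible D i j, beta D r i j t * (x.val (zeta D i j t) 0 0 - x.val i j t)

/-- The linear constraints on the variables `x^t_{i,j}` for minimum distance `d`. On `𝓘` the
natural-number subtractions below do not truncate. -/
structure LinearConstraints (D d : ℕ) (x : Variables D) : Prop where
  one : x.val 0 0 0 = 1
  bounds : ∀ i j t, (i, j, t) ∈ index D → 0 ≤ x.val i j t ∧ x.val i j t ≤ x.val i 0 0
  perm_low : ∀ i j t i' j' t', (i, j, t) ∈ index D → (i', j', t') ∈ index D →
    i + j - 2 * t ≤ D →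
    [i', j', i' + j' - 2 * t'].Perm [i, j, i + j - 2 * t] →
    x.val i j t = x.val i' j' t'
  perm_high : ∀ i j t i' j' t', (i, j, t) ∈ index D → (i', j', t') ∈ index D →
    D + 1 ≤ i + j - 2 * t → i + j - 2 * t ≤ 2 * D - 2 →
    [i', j', 2 * D - (i' + j' - 2 * t')].Perm [i, j, 2 * D - (i + j - 2 * t)] →
    x.val i j t = x.val i' j' t'
  zero : ∀ i j t, (i, j, t) ∈ index D →
    (∃ k ∈ [i, j, i + j - 2 * t, 2 * D - (i + j - 2 * t)], 1 ≤ k ∧ k ≤ d - 1) →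
    x.val i j t = 0

/-- The feasible points of the semidefinite program for odd `D`: the linear constraints, and
positive semidefinite blocks for even `r ≤ D - 1` and for odd `r ≤ D - 2`. -/
structure Feasible (D d : ℕ) (x : Variables D) : Prop extends LinearConstraints D d x where
  block_even : ∀ r, Even r → r ≤ D - 1 → (block D r D x).PosSemidef
  block_odd : ∀ r, Odd r → r ≤ D - 2 → (block D r (D - 1) x).PosSemidef
  coblock_even : ∀ r, Even r → r ≤ D - 1 → (coblock D r D x).PosSemidef
  coblock_odd : ∀ r, Odd r → r ≤ D - 2 → (coblock D r (D - 1) x).PosSemidef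

/-- The objective `∑_{i=0}^{D-1} (2D choose i) x^0_{i,0} + (1/2) (2D choose D) x^0_{D,0}`. -/
noncomputable def objective (D : ℕ) (x : Variables D) : ℝ :=
  ∑ i ∈ range D, ((2 * D).choose i : ℝ) * x.val i 0 0 +
    1 / 2 * ((2 * D).choose D : ℝ) * x.val D 0 0

end FoldedCube

namespace FoldedCube

open Finset
open scoped symmDiff

/-! Every code gives a feasible point whose objective value is its size, so the optimum bounds the
largest code; the maximum is attained because the feasible set is compact.

Replace a code `C` by the complement-closed family `A = lift C`, which has `2 * #C` members. For
sets `u`, `v` let `corr A E u v` count the pairs of a permutation `σ` and a centre `c ∈ E` with `c ∆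
σu` and `c ∆ σv` in `A`. This is a Gram kernel, hence positive semidefinite (`corr_posSemidef`),
invariant under permutations and, since `A` is complement-closed, under complementing either
argument. So `corr A A u v`, divided by `n! * #A` with `n = 2D`, depends only on `#u`, `#v`, `#(u ∩
v)`, and serves as `x^t_{i,j}`. Moving the centre `c` to `c ∆ σu` gives the permutation constraints
(`corr_eq_of_perm`) and `corr_univ`; the latter identifies the kernel with centres outside `A` as
the one behind the second family of matrices.

For the semidefinite constraints, compress an invariant kernel to one test vector per set size `i`:
the restriction to `i`-sets of the product, over `r` disjoint pairs, of differences of indicators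
(`pairSign r`). These are mapped to multiples of each other by the incidence matrices of prescribed
intersection size; a generating function computes the multipliers (`sum_pairSign_mul_monomial`,
`coeff_generating`). The compression is `2 ^ r` times the block (`sum_beta_eq`). In rows or columns
of size `D`, complementation merges two intersection sizes, which produces the two-term coefficients
and the tie factor. Only positivity of the compressions is needed, not a full block diagonalization.
-/

/-! ### Sign vectors of disjoint pairs and their eigenvalues -/

/-- Generating function of the subsets of `range (2 * r)`, weighted by a factor for each of the
pairs `{2k, 2k+1}`. -/
lemma sum_powerset_range_pairs {R : Type*} [CommRing R] (g : Bool → Bool → R) (x : ℕ → R) (r : ℕ) :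
    ∑ v ∈ (range (2 * r)).powerset,
        (∏ k ∈ range r, g (decide (2 * k ∈ v)) (decide (2 * k + 1 ∈ v))) * ∏ s ∈ v, x s =
      ∏ k ∈ range r, (g false false + g true false * x (2 * k) + g false true * x (2 * k + 1) +
        g true true * (x (2 * k) * x (2 * k + 1))) := by
  induction r with
  | zero => simp
  | succ r ih =>
    have hr : range (2 * (r + 1)) = insert (2 * r + 1) (insert (2 * r) (range (2 * r))) := by
      rw [show 2 * (r + 1) = 2 * r + 1 + 1 by ring, range_add_one, range_add_one]
    rw [hr, sum_powerset_insert (by simp), sum_powerset_insert (by simp),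
      sum_powerset_insert (by simp), prod_range_succ, ← ih, sum_mul, ← sum_add_distrib,
      ← sum_add_distrib, ← sum_add_distrib]
    refine sum_congr rfl fun v hv => ?_
    have hv' : ∀ k, 2 * r ≤ k → k ∉ v := fun k hk h => by
      have := mem_range.1 (mem_powerset.1 hv h); omega
    have h0 := hv' (2 * r) le_rfl
    have h1 := hv' (2 * r + 1) (by omega)
    have e : ∀ w : Finset ℕ, (∀ k < 2 * r, k ∈ w ↔ k ∈ v) →
        ∏ k ∈ range r, g (decide (2 * k ∈ w)) (decide (2 * k + 1 ∈ w)) =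
          ∏ k ∈ range r, g (decide (2 * k ∈ v)) (decide (2 * k + 1 ∈ v)) := by
      intro w hw
      refine prod_congr rfl fun k hk => ?_
      have := mem_range.1 hk
      simp only [hw (2 * k) (by omega), hw (2 * k + 1) (by omega)]
    simp only [prod_range_succ]
    rw [e (insert (2 * r) v) (fun k hk => by simp; omega),
      e (insert (2 * r + 1) v) (fun k hk => by simp; omega),
      e (insert (2 * r + 1) (insert (2 * r) v)) (fun k hk => by
        simp only [mem_insert, hk.ne, show k ≠ 2 * r + 1 by omega, false_or]),
      prod_insert h0, prod_insert h1, prod_insert (by simp [h1]), prod_insert h0]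
    simp only [h0, h1, mem_insert, decide_false, decide_true, or_true, or_false,
      show ¬ 2 * r = 2 * r + 1 by omega, show ¬ 2 * r + 1 = 2 * r by omega]
    ring

lemma sum_powerset_range_add {R : Type*} [CommRing R] (g : Bool → Bool → R) (x : ℕ → R)
    (r m : ℕ) :
    ∑ v ∈ (range (2 * r + m)).powerset,
        (∏ k ∈ range r, g (decide (2 * k ∈ v)) (decide (2 * k + 1 ∈ v))) * ∏ s ∈ v, x s =
      (∏ k ∈ range r, (g false false + g true false * x (2 * k) + g false true * x (2 * k + 1) +
        g true true * (x (2 * k) * x (2 * k + 1)))) * ∏ s ∈ range m, (1 + x (2 * r + s)) := by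
  induction m with
  | zero => simpa using sum_powerset_range_pairs g x r
  | succ m ih =>
    rw [← add_assoc, range_add_one, sum_powerset_insert (by simp), prod_range_succ, ← mul_assoc,
      ← ih, mul_add, mul_one, sum_mul]
    congr 1
    refine sum_congr rfl fun v hv => ?_
    have h : 2 * r + m ∉ v := fun h => by
      have := mem_range.1 (mem_powerset.1 hv h); omega
    rw [prod_insert h]
    have : ∏ k ∈ range r, g (decide (2 * k ∈ insert (2 * r + m) v))
        (decide (2 * k + 1 ∈ insert (2 * r + m) v)) =
          ∏ k ∈ range r, g (decide (2 * k ∈ v)) (decide (2 * k + 1 ∈ v)) := by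
      refine prod_congr rfl fun k hk => ?_
      have := mem_range.1 hk
      simp only [mem_insert, show ¬ 2 * k = 2 * r + m by omega,
        show ¬ 2 * k + 1 = 2 * r + m by omega, false_or]
    rw [this]
    ring

/-- The value at `u` of the product of the differences of the indicators of `2k ∈ u` and
`2k+1 ∈ u`, for `k < r`. -/
def pairSign (r : ℕ) (u : Finset ℕ) : ℤ :=
  ∏ k ∈ range r, ((if 2 * k ∈ u then 1 else 0) - (if 2 * k + 1 ∈ u then 1 else 0))

/-- A nonzero product forces `u` to contain exactly one element of each of the `r` pairs. -/
lemma card_inter_range_of_pairSign_ne_zero {r : ℕ} {u : Finset ℕ} (h : pairSign r u ≠ 0) :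
    #(u ∩ range (2 * r)) = r := by
  induction r with
  | zero => simp
  | succ r ih =>
    rw [pairSign, prod_range_succ] at h
    have h1 := ih (left_ne_zero_of_mul h)
    have h2 := right_ne_zero_of_mul h
    have hr : range (2 * (r + 1)) = insert (2 * r + 1) (insert (2 * r) (range (2 * r))) := by
      rw [show 2 * (r + 1) = 2 * r + 1 + 1 by ring, range_add_one, range_add_one]
    rw [hr]
    by_cases ha : 2 * r ∈ u <;> by_cases hb : 2 * r + 1 ∈ u <;> simp [ha, hb] at h2 <;>
      simp [ha, hb, inter_insert_of_mem, inter_insert_of_notMem, h1]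

open Polynomial in
lemma coeff_X_pow_mul_one_add_X_pow {R : Type*} [CommRing R] (a N m : ℕ) :
    ((X : R[X]) ^ a * (1 + X) ^ N).coeff m = ((binom N ((m : ℤ) - a) : ℤ) : R) := by
  rw [coeff_X_pow_mul', coeff_one_add_X_pow, binom]
  by_cases h : a ≤ m
  · have e : ((m : ℤ) - a) = ((m - a : ℕ) : ℤ) := by omega
    rw [e]
    by_cases h2 : m - a ≤ N
    · rw [if_pos h, if_pos ⟨by omega, by omega⟩]; simp
    · rw [if_pos h, if_neg (by omega), Nat.choose_eq_zero_of_lt (not_le.1 h2)]; simp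
  · rw [if_neg h, if_neg (by omega)]; simp

/-- The square of `pairSign r` is the indicator of splitting every pair, so the generating function
by size is `(2X)^r (1 + X)^m`. -/
lemma sum_pairSign_sq (r m i : ℕ) :
    ∑ u ∈ (range (2 * r + m)).powerset, (if #u = i then pairSign r u * pairSign r u else 0) =
      2 ^ r * binom m (i - r) := by
  have h := sum_powerset_range_add (R := Polynomial ℤ)
    (fun p q => if p = q then 0 else 1) (fun _ => Polynomial.X) r m
  have h' := congrArg (fun p => Polynomial.coeff p i) h
  simp only [Polynomial.finsetSum_coeff, prod_const, card_range] at h'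
  have e : ∀ u : Finset ℕ, (if #u = i then pairSign r u * pairSign r u else 0) =
      ((∏ k ∈ range r, (if decide (2 * k ∈ u) = decide (2 * k + 1 ∈ u) then 0 else 1)) *
        Polynomial.X ^ #u : Polynomial ℤ).coeff i := by
    intro u
    have : (∏ k ∈ range r, (if decide (2 * k ∈ u) = decide (2 * k + 1 ∈ u) then 0 else 1) :
        Polynomial ℤ) = Polynomial.C (pairSign r u * pairSign r u) := by
      rw [pairSign, ← prod_mul_distrib, map_prod]
      refine prod_congr rfl fun k _ => ?_
      by_cases ha : 2 * k ∈ u <;> by_cases hb : 2 * k + 1 ∈ u <;> simp [ha, hb]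
    rw [this, Polynomial.coeff_C_mul_X_pow]
    simp [eq_comm]
  rw [sum_congr rfl fun u _ => e u, h']
  simp only [if_true, reduceCtorEq, if_false, zero_add, zero_mul, add_zero, one_mul]
  rw [← two_mul, mul_pow, mul_assoc,
    show (2 : Polynomial ℤ) ^ r = Polynomial.C (2 ^ r) by simp, Polynomial.coeff_C_mul,
    coeff_X_pow_mul_one_add_X_pow]
  simp

open Polynomial in
-- The eigenvector property for all intersection sizes at once. Write `Y = C X` for the weight of
-- elements of `u` and `X` for the others. A pair split by `u` contributes `±(Y - X)` with the sign
-- of its factor in `pairSign r u`; an unsplit pair contributes `0`; each unpaired element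
-- contributes `1 + Y` or `1 + X`.
lemma sum_pairSign_mul_monomial (r m : ℕ) (u : Finset ℕ) (hu : u ⊆ range (2 * r + m)) :
    ∑ v ∈ (range (2 * r + m)).powerset,
        (C (C (pairSign r v)) : ℤ[X][X]) * (C X ^ #(v ∩ u) * X ^ #(v \ u)) =
      C (C (pairSign r u)) * ((C X - X) ^ r * ((1 + C X) ^ (#u - r) * (1 + X) ^ (r + m - #u))) := by
  have h := sum_powerset_range_add (R := ℤ[X][X])
    (fun p q => (if p then 1 else 0) - (if q then 1 else 0))
    (fun s => if s ∈ u then C X else X) r m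
  have e : ∀ v : Finset ℕ, (∏ k ∈ range r, ((if decide (2 * k ∈ v) = true then 1 else 0) -
      (if decide (2 * k + 1 ∈ v) = true then 1 else 0)) : ℤ[X][X]) = C (C (pairSign r v)) := by
    intro v
    rw [pairSign, map_prod, map_prod]
    refine prod_congr rfl fun k _ => ?_
    by_cases ha : 2 * k ∈ v <;> by_cases hb : 2 * k + 1 ∈ v <;> simp [ha, hb]
  have e2 : ∀ v : Finset ℕ, (∏ s ∈ v, if s ∈ u then C X else X : ℤ[X][X]) =
      C X ^ #(v ∩ u) * X ^ #(v \ u) := by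
    intro v
    rw [prod_ite, prod_const, prod_const, filter_mem_eq_inter, filter_notMem_eq_sdiff]
  simp only [e, e2, if_true, reduceCtorEq, if_false, sub_zero, zero_sub, sub_self, zero_add,
    zero_mul, one_mul, add_zero] at h
  rw [h]
  have e3 : (∏ k ∈ range r, ((if 2 * k ∈ u then C X else X) +
      (-1 : ℤ[X][X]) * (if 2 * k + 1 ∈ u then C X else X)) : ℤ[X][X]) =
      C (C (pairSign r u)) * (C X - X) ^ r := by
    rw [pairSign, map_prod, map_prod, ← card_range r, ← prod_const, card_range,
      ← prod_mul_distrib]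
    refine prod_congr rfl fun k _ => ?_
    by_cases ha : 2 * k ∈ u <;> by_cases hb : 2 * k + 1 ∈ u <;> simp [ha, hb] <;> ring
  rw [e3]
  -- The exponents on the right are correct only if `u` splits every pair; otherwise both sides
  -- vanish.
  by_cases h0 : pairSign r u = 0
  · simp [h0]
  have hc := card_inter_range_of_pairSign_ne_zero h0
  have e4 : (∏ s ∈ range m, (1 + if 2 * r + s ∈ u then C X else X) : ℤ[X][X]) =
      (1 + C X) ^ (#u - r) * (1 + X) ^ (r + m - #u) := by
    have : ∀ s, (1 + if 2 * r + s ∈ u then C X else X : ℤ[X][X]) =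
        if 2 * r + s ∈ u then 1 + C X else 1 + X := fun s => by split_ifs <;> rfl
    simp only [this]
    rw [prod_ite, prod_const, prod_const]
    have c1 : #{s ∈ range m | 2 * r + s ∈ u} + #(u ∩ range (2 * r)) = #u := by
      rw [← card_map (addLeftEmbedding (2 * r)), ← card_union_of_disjoint]
      · congr 1
        ext s
        simp only [mem_union, mem_map, mem_filter, mem_range, addLeftEmbedding_apply, mem_inter]
        constructor
        · rintro (⟨a, h, rfl⟩ | h)
          · exact h.2
          · exact h.1
        · intro hs
          by_cases h : s < 2 * r
          · exact Or.inr ⟨hs, h⟩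
          · have := mem_range.1 (hu hs)
            exact Or.inl ⟨s - 2 * r, ⟨by omega, by rwa [Nat.add_sub_cancel' (not_lt.1 h)]⟩,
              Nat.add_sub_cancel' (not_lt.1 h)⟩
      · rw [disjoint_left]
        simp only [mem_map, mem_filter, mem_range, addLeftEmbedding_apply, mem_inter]
        rintro _ ⟨a, h, rfl⟩ ⟨_, h'⟩
        omega
    have c2 := card_filter_add_card_filter_not (s := range m) (fun s => 2 * r + s ∈ u)
    rw [card_range] at c2
    rw [show #{s ∈ range m | 2 * r + s ∈ u} = #u - r by omega,
      show #{s ∈ range m | ¬ 2 * r + s ∈ u} = r + m - #u by omega]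
  rw [e4]
  ring

/-- The eigenvalue of the matrices `M^t_{i,j}` on the functions `pairSign r`. -/
def eigenvalue (D r i j t : ℕ) : ℤ :=
  ∑ l ∈ range D, signedChoose r l * binom (i - l) (t - l) * binom (2 * D - i - r + l) (j - r - t + l)

open Polynomial in
lemma coeff_generating {r i n s t : ℕ} (hi : r ≤ i) (hn : i + r ≤ n) :
    (((C X - X) ^ r * ((1 + C X) ^ (i - r) * (1 + X) ^ (n - r - i)) : ℤ[X][X]).coeff s).coeff t =
      ∑ l ∈ range (r + 1),
        signedChoose r l * binom (i - l) (t - l) * binom (n - i - r + l) (s - r + l) := by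
  have e : ((C X - X) ^ r * ((1 + C X) ^ (i - r) * (1 + X) ^ (n - r - i)) : ℤ[X][X]) =
      ∑ l ∈ range (r + 1), C (C (signedChoose r l)) * (C (X ^ l * (1 + X) ^ (i - l)) *
        (X ^ (r - l) * (1 + X) ^ (n - i - r + l))) := by
    -- Expanding `Y - X` as `Y(1 + X) - X(1 + Y)` yields the form of the sum over `l` used in `β`,
    -- rather than the direct expansion.
    rw [show (C X - X : ℤ[X][X]) = C X * (1 + X) + (-(X * (1 + C X)) : ℤ[X][X]) by ring, add_pow, sum_mul]
    refine sum_congr rfl fun l hl => ?_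
    have hl : l ≤ r := by simpa [Nat.lt_succ_iff] using hl
    rw [show i - l = (i - r) + (r - l) by omega, show n - i - r + l = (n - r - i) + l by omega,
      neg_pow (X * (1 + C X) : ℤ[X][X]) (r - l), signedChoose]
    simp only [map_mul, map_pow, map_add, map_one, map_neg, map_natCast, mul_pow, pow_add]
    ring
  rw [e, finsetSum_coeff, finsetSum_coeff]
  refine sum_congr rfl fun l hl => ?_
  have hl : l ≤ r := by simpa [Nat.lt_succ_iff] using hl
  rw [coeff_C_mul, coeff_C_mul, coeff_C_mul, coeff_X_pow_mul_one_add_X_pow]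
  rw [← C_eq_intCast, coeff_mul_C, coeff_X_pow_mul_one_add_X_pow]
  push_cast [show l ≤ i by omega, show r ≤ n - i by omega, show i ≤ n by omega, hl]
  rw [mul_assoc, show (s : ℤ) - (r - l) = s - r + l by ring]

lemma sum_pairSign_eq {r n i s t : ℕ} {u : Finset ℕ} (hu : u ⊆ range n) (hi : #u = i)
    (hr : r ≤ i) (hn : i + r ≤ n) :
    ∑ v ∈ (range n).powerset, (if #(v \ u) = s ∧ #(v ∩ u) = t then pairSign r v else 0) =
      pairSign r u * ∑ l ∈ range (r + 1),
        signedChoose r l * binom (i - l) (t - l) * binom (n - i - r + l) (s - r + l) := by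
  obtain ⟨m, rfl⟩ : ∃ m, n = 2 * r + m := ⟨n - 2 * r, by omega⟩
  have h := congrArg (fun p => (Polynomial.coeff p s).coeff t) (sum_pairSign_mul_monomial r m u hu)
  simp only [Polynomial.finsetSum_coeff, Polynomial.coeff_C_mul] at h
  rw [hi, show r + m - i = 2 * r + m - r - i by omega, coeff_generating hr hn] at h
  rw [← h]
  refine sum_congr rfl fun v _ => ?_
  rw [← Polynomial.C_pow, Polynomial.coeff_C_mul, Polynomial.coeff_X_pow]
  by_cases h1 : s = #(v \ u) <;> by_cases h2 : t = #(v ∩ u) <;>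
    simp [h1, h2, Polynomial.coeff_X_pow, eq_comm]

lemma signedChoose_eq_zero {r l : ℕ} (h : r < l) : signedChoose r l = 0 := by
  simp [signedChoose, Nat.choose_eq_zero_of_lt h]

/-- Summing over `v` first gives an eigenvalue times `pairSign r u`; the remaining sum over `u` is
the squared norm from `sum_pairSign_sq`. -/
lemma sum_pairSign_mul_pairSign {D r i j t : ℕ} (hr : r < D) (hri : r ≤ i) (hi : i ≤ D)
    (ht : t ≤ j) :
    ∑ u ∈ (range (2 * D)).powerset, ∑ v ∈ (range (2 * D)).powerset,
        (if #u = i ∧ #v = j ∧ #(u ∩ v) = t then pairSign r u * pairSign r v else 0) =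
      2 ^ r * (binom (2 * D - 2 * r) (i - r) * eigenvalue D r i j t) := by
  have h1 : ∀ u ∈ (range (2 * D)).powerset, ∑ v ∈ (range (2 * D)).powerset,
        (if #u = i ∧ #v = j ∧ #(u ∩ v) = t then pairSign r u * pairSign r v else 0) =
      (if #u = i then pairSign r u * pairSign r u else 0) * eigenvalue D r i j t := by
    intro u hu
    split_ifs with h
    · have := sum_pairSign_eq (r := r) (s := j - t) (t := t) (mem_powerset.1 hu) h hri (by omega)
      have e : eigenvalue D r i j t = ∑ l ∈ range (r + 1),
        signedChoose r l * binom (i - l) (t - l) *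
          binom ((2 * D : ℕ) - i - r + l) ((j - t : ℕ) - r + l) := by
        rw [eigenvalue]
        refine (sum_subset (range_subset_range.2 (show r + 1 ≤ D by omega)) fun l _ hl => ?_).symm.trans ?_
        · rw [signedChoose_eq_zero (by simpa using hl)]; simp
        · refine sum_congr rfl fun l _ => ?_
          push_cast [ht]
          congr 2
          ring
      rw [e, mul_assoc, ← this, mul_sum]
      refine sum_congr rfl fun v _ => ?_
      have := card_sdiff_add_card_inter v u
      rw [inter_comm u v]
      by_cases h2 : #(v ∩ u) = t
      · by_cases h3 : #v = j
        · rw [if_pos ⟨h, h3, h2⟩, if_pos ⟨by omega, h2⟩]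
        · rw [if_neg (by tauto), if_neg (by omega), mul_zero]
      · rw [if_neg (by tauto), if_neg (by tauto), mul_zero]
    · rw [zero_mul]
      exact sum_eq_zero fun v _ => if_neg (by tauto)
  rw [sum_congr rfl h1, ← sum_mul, ← mul_assoc]
  congr 1
  have := sum_pairSign_sq r (2 * D - 2 * r) i
  rw [show 2 * r + (2 * D - 2 * r) = 2 * D by omega] at this
  rw [this]
  push_cast [show 2 * r ≤ 2 * D by omega]
  rfl

lemma sum_map_valEmbedding {M : Type*} [AddCommMonoid M] (n : ℕ) (F : Finset ℕ → M) :
    ∑ v : Finset (Fin n), F (v.map Fin.valEmbedding) = ∑ v ∈ (range n).powerset, F v := by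
  refine sum_bij (fun v _ => v.map Fin.valEmbedding) ?_ ?_ ?_ ?_
  · intro v _
    rw [mem_powerset]
    intro a ha
    obtain ⟨b, _, rfl⟩ := mem_map.1 ha
    simp
  · intro v _ w _ h
    exact map_injective _ h
  · intro v hv
    refine ⟨v.attachFin fun a ha => mem_range.1 (mem_powerset.1 hv ha), mem_univ _, ?_⟩
    ext a
    simp only [mem_map, mem_attachFin, Fin.valEmbedding_apply]
    exact ⟨by rintro ⟨b, h, rfl⟩; exact h,
      fun h => ⟨⟨a, mem_range.1 (mem_powerset.1 hv h)⟩, h, rfl⟩⟩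
  · intro v _
    rfl

/-- `pairSign` as a real function on the subsets of `Fin n`. -/
def vecSign {n : ℕ} (r : ℕ) (u : Finset (Fin n)) : ℝ := (pairSign r (u.map Fin.valEmbedding) : ℝ)

lemma sum_vecSign_mul_vecSign {D r i j t : ℕ} (hr : r < D) (hri : r ≤ i) (hi : i ≤ D)
    (ht : t ≤ j) :
    ∑ u : Finset (Fin (2 * D)), ∑ v : Finset (Fin (2 * D)),
        (if #u = i ∧ #v = j ∧ #(u ∩ v) = t then vecSign r u * vecSign r v else 0) =
      2 ^ r * ((binom (2 * D - 2 * r) (i - r) * eigenvalue D r i j t : ℤ) : ℝ) := by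
  have h := congrArg (Int.cast : ℤ → ℝ) (sum_pairSign_mul_pairSign hr hri hi ht)
  push_cast at h
  push_cast
  rw [← h, ← sum_map_valEmbedding]
  refine sum_congr rfl fun u _ => ?_
  rw [← sum_map_valEmbedding]
  refine sum_congr rfl fun v _ => ?_
  rw [← map_inter, card_map, card_map, card_map]
  rfl

/-! ### The coefficients `β` in terms of eigenvalues -/

lemma binom_symm (a b : ℤ) : binom a b = binom a (a - b) := by
  unfold binom
  by_cases h : 0 ≤ b ∧ b ≤ a
  · rw [if_pos h, if_pos (by omega), show (a - b).toNat = a.toNat - b.toNat by omega,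
      Nat.choose_symm (by omega)]
  · rw [if_neg h, if_neg (by omega)]

lemma binom_eq_of_add_eq {a b c : ℤ} (h : b + c = a) : binom a b = binom a c := by
  rw [binom_symm, show a - b = c by omega]

lemma signedChoose_sub {r l : ℕ} (hr : Even r) (hl : l ≤ r) :
    signedChoose r (r - l) = signedChoose r l := by
  unfold signedChoose
  rw [Nat.choose_symm hl, Nat.sub_sub_self hl]
  congr 1
  rcases Nat.even_or_odd l with h | h
  · rw [h.neg_one_pow, ((Nat.even_sub hl).2 (iff_of_true hr h)).neg_one_pow]
  · rw [h.neg_one_pow, (Nat.Even.sub_odd hl hr h).neg_one_pow]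

lemma sum_signedChoose_range {D r : ℕ} (hr : r < D) (A : ℕ → ℤ) :
    ∑ l ∈ range D, signedChoose r l * A l = ∑ l ∈ range (r + 1), signedChoose r l * A l := by
  refine (sum_subset (range_subset_range.2 (show r + 1 ≤ D by omega)) fun l _ hl => ?_).symm
  rw [signedChoose_eq_zero (by simpa using hl), zero_mul]

lemma sum_signedChoose_reflect {D r : ℕ} (hr : r < D) (he : Even r) {A B : ℕ → ℤ}
    (h : ∀ l ≤ r, A (r - l) = B l) :
    ∑ l ∈ range D, signedChoose r l * B l = ∑ l ∈ range D, signedChoose r l * A l := by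
  rw [sum_signedChoose_range hr, sum_signedChoose_range hr, ← sum_range_reflect]
  refine sum_congr rfl fun l hl => ?_
  have hl : l ≤ r := by simpa [Nat.lt_succ_iff] using hl
  rw [show r + 1 - 1 - l = r - l by omega, signedChoose_sub he hl, ← h _ (Nat.sub_le _ _),
    Nat.sub_sub_self hl]

/-- For even `r` the sign and binomial weight is symmetric under `l ↦ r - l`, so the lower half of
the sum moves to the upper half, and the fixed point `l = r / 2` occurs once. -/
lemma sum_signedChoose_fold {D r : ℕ} (hr : r < D) (he : Even r) {A B : ℕ → ℤ}
    (h : ∀ l ≤ r, A (r - l) = B l) :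
    ∑ l ∈ Ico (r / 2 + 1) D, signedChoose r l * (A l + B l) +
        signedChoose r (r / 2) * A (r / 2) = ∑ l ∈ range D, signedChoose r l * A l := by
  obtain ⟨q, rfl⟩ := he
  rw [show (q + q) / 2 = q by omega] at *
  have e1 : ∑ l ∈ Ico (q + 1) D, signedChoose (q + q) l * B l =
      ∑ l ∈ range q, signedChoose (q + q) l * A l := by
    have : ∑ l ∈ Ico (q + 1) D, signedChoose (q + q) l * B l =
        ∑ l ∈ Ico (q + 1) (q + q + 1), signedChoose (q + q) l * B l := by
      refine (sum_subset (Ico_subset_Ico_right (by omega)) fun l h1 h2 => ?_).symm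
      simp only [mem_Ico] at h1 h2
      rw [signedChoose_eq_zero (by omega), zero_mul]
    rw [this]
    refine sum_nbij' (fun l => q + q - l) (fun l => q + q - l) ?_ ?_ ?_ ?_ ?_
    · intro l hl; simp only [mem_Ico, mem_range] at *; omega
    · intro l hl; simp only [mem_Ico, mem_range] at *; omega
    · intro l hl; simp only [mem_Ico] at *; omega
    · intro l hl; simp only [mem_range] at *; omega
    · intro l hl
      simp only [mem_Ico] at hl
      rw [signedChoose_sub ⟨q, rfl⟩ (by omega), h _ (by omega)]
  simp only [mul_add, sum_add_distrib]
  rw [e1, ← sum_range_add_sum_Ico _ (show q + 1 ≤ D by omega), sum_range_succ]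
  ring

/-- The reflection `l ↦ r - l` swaps the two binomial factors. Conceptually, complementing a `D`-set
exchanges `t` with `j - t` and multiplies `pairSign r` by `(-1)^r`. -/
lemma eigenvalue_sub_of_even {D r j t : ℕ} (hr : r < D) (he : Even r) (ht : t ≤ j) :
    eigenvalue D r D j (j - t) = eigenvalue D r D j t := by
  unfold eigenvalue
  simp only [mul_assoc]
  refine sum_signedChoose_reflect hr he fun l hl => ?_
  push_cast [hl, ht]
  rw [mul_comm]
  congr 2 <;> ring

lemma betaRow_eq {D r j t : ℕ} (hr : r < D) (he : Even r) (ht : t ≤ j) :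
    betaRow D r j t = binom (2 * D - 2 * r) (D - r) *
      (eigenvalue D r D j t + eigenvalue D r D j (j - t)) := by
  rw [eigenvalue_sub_of_even hr he ht, ← two_mul, betaRow, mul_comm 2, mul_assoc, eigenvalue]
  simp only [mul_assoc]
  rw [← sum_signedChoose_fold hr he (B := fun l =>
    binom (D - r + l) (t - r + l) * binom (D - l) (j - t - l)) ?_]
  · obtain ⟨q, rfl⟩ := he
    rw [show (q + q) / 2 = q by omega]
    push_cast
    congr 3
    · refine sum_congr rfl fun l _ => ?_
      congr 4 <;> ring
    · rw [show (2 * D - D - (q + q) + q : ℤ) = D - q by ring,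
        show (j - (q + q) - t + q : ℤ) = j - t - q by ring]
      ring
  · intro l hl
    push_cast [hl]
    congr 2 <;> ring

/-- The two bracketed products are already the summands for `t` and `i - t`, up to the symmetry of
binomial coefficients, so no reflection in `l` and no parity are involved. -/
lemma betaCol_eq {D r i t : ℕ} (ht : t ≤ i) :
    betaCol D r i t = binom (2 * D - 2 * r) (i - r) *
      (eigenvalue D r i D t + eigenvalue D r i D (i - t)) := by
  rw [betaCol, eigenvalue, eigenvalue, ← sum_add_distrib]
  congr 1
  refine sum_congr rfl fun l _ => ?_
  rw [mul_assoc, mul_assoc, ← mul_add]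
  push_cast [ht]
  rw [binom_eq_of_add_eq (b := (i : ℤ) - t - l) (c := t) (by ring),
    binom_eq_of_add_eq (b := (D : ℤ) - r - (i - t) + l) (c := D - t) (by ring),
    show (2 * D - r - i + l : ℤ) = 2 * D - i - r + l by ring,
    show (D - r - t + l : ℤ) = D - r - t + l by ring]

lemma betaCorner_eq {D r t : ℕ} (hr : r < D) (he : Even r) (ht : t ≤ D) :
    betaCorner D r t = binom (2 * D - 2 * r) (D - r) *
      (eigenvalue D r D D t + eigenvalue D r D D (D - t)) := by
  rw [eigenvalue_sub_of_even hr he ht, ← two_mul, betaCorner, mul_comm 2, mul_assoc, eigenvalue]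
  simp only [mul_assoc]
  rw [← sum_signedChoose_fold hr he (B := fun l => binom (D - l) t * binom (D - r + l) (D - t)) ?_]
  · obtain ⟨q, rfl⟩ := he
    rw [show (q + q) / 2 = q by omega]
    push_cast
    congr 3
    · refine sum_congr rfl fun l _ => ?_
      rw [show (2 * D - D - (q + q) + l : ℤ) = D - (q + q) + l by ring,
        binom_eq_of_add_eq (b := (t : ℤ)) (c := D - (q + q) - t + l) (by ring)]
    · rw [show (2 * D - D - (q + q) + q : ℤ) = D - q by ring,
        binom_eq_of_add_eq (b := (t : ℤ)) (c := D - (q + q) - t + q) (by ring),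
        binom_eq_of_add_eq (b := (D - t : ℤ)) (c := t - q) (by ring)]
  · intro l hl
    push_cast [hl]
    rw [mul_comm, show (2 * D - D - r + (r - l) : ℤ) = D - l by ring,
      show (D - (r - l) : ℤ) = D - r + l by ring,
      binom_eq_of_add_eq (b := (D - r - t + (r - l) : ℤ)) (c := t) (by ring),
      binom_eq_of_add_eq (b := (t - (r - l) : ℤ)) (c := D - t) (by ring)]

/-! ### Compressing invariant kernels to the blocks -/

/-- Source of the tie factor: `s` and `m - s` share the representative `max s (m - s)`, and at `2 *
t = m` the sum `Q t + Q (m - t)` counts a single term twice. -/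
lemma sum_range_fold (m : ℕ) (Q y : ℕ → ℝ) :
    ∑ s ∈ range (m + 1), Q s * y (max s (m - s)) =
      ∑ t ∈ (range (m + 1)).filter (fun t => (m + 1) / 2 ≤ t),
        (if 2 * t = m then 1 / 2 else 1) * (Q t + Q (m - t)) * y t := by
  have e : ∀ s ∈ range (m + 1), Q s * y (max s (m - s)) =
      (if m < 2 * s then Q s * y s else 0) + (if 2 * s < m then Q s * y (m - s) else 0) +
        (if 2 * s = m then Q s * y s else 0) := by
    intro s _
    rcases lt_trichotomy (2 * s) m with h | h | h
    · rw [if_neg (by omega), if_pos h, if_neg (by omega), max_eq_right (by omega)]; ring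
    · rw [if_neg (by omega), if_neg (by omega), if_pos h, max_eq_left (by omega)]; ring
    · rw [if_pos h, if_neg (by omega), if_neg (by omega), max_eq_left (by omega)]; ring
  rw [sum_congr rfl e, sum_add_distrib, sum_add_distrib,
    ← sum_range_reflect (fun s => if 2 * s < m then Q s * y (m - s) else 0), ← sum_add_distrib,
    ← sum_add_distrib, sum_filter]
  refine sum_congr rfl fun s hs => ?_
  have hs := mem_range.1 hs
  rw [show m + 1 - 1 - s = m - s by omega, show m - (m - s) = s by omega]
  rcases lt_trichotomy (2 * s) m with h | h | h
  · rw [if_neg (by omega), if_neg (by omega), if_neg (by omega), if_neg (by omega)]; ring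
  · rw [if_neg (by omega), if_neg (by omega), if_pos h, if_pos (by omega), if_pos h,
      show m - s = s by omega]; ring
  · rw [if_pos h, if_pos (by omega), if_neg (by omega), if_pos (by omega), if_neg (by omega)]; ring

lemma sum_vecSign_kernel {D r i j : ℕ} (hr : r < D) (hri : r ≤ i) (hi : i ≤ D)
    {K : Finset (Fin (2 * D)) → Finset (Fin (2 * D)) → ℝ} {y : ℕ → ℝ}
    (hK : ∀ u v, #u = i → #v = j → K u v = y #(u ∩ v)) :
    ∑ u, ∑ v, (if #u = i ∧ #v = j then vecSign r u * vecSign r v * K u v else 0) =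
      2 ^ r * ∑ t ∈ range (min i j + 1),
        ((binom (2 * D - 2 * r) (i - r) * eigenvalue D r i j t : ℤ) : ℝ) * y t := by
  have e : ∀ u v : Finset (Fin (2 * D)),
      (if #u = i ∧ #v = j then vecSign r u * vecSign r v * K u v else 0) =
        ∑ t ∈ range (min i j + 1), (if #u = i ∧ #v = j ∧ #(u ∩ v) = t then
          vecSign r u * vecSign r v else 0) * y t := by
    intro u v
    by_cases h : #u = i ∧ #v = j
    · have hm : #(u ∩ v) ∈ range (min i j + 1) := by
        have h1 := card_le_card (inter_subset_left (s₁ := u) (s₂ := v))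
        have h2 := card_le_card (inter_subset_right (s₁ := u) (s₂ := v))
        rw [mem_range]
        omega
      rw [sum_eq_single_of_mem _ hm, if_pos h, if_pos ⟨h.1, h.2, rfl⟩, hK u v h.1 h.2]
      intro t _ ht
      rw [if_neg (by tauto), zero_mul]
    · rw [if_neg h]
      refine (sum_eq_zero fun t _ => ?_).symm
      rw [if_neg (by tauto), zero_mul]
  simp only [e]
  rw [sum_congr rfl fun u _ => sum_comm, sum_comm, mul_sum]
  refine sum_congr rfl fun t ht => ?_
  have ht := mem_range.1 ht
  simp only [← sum_mul]
  rw [sum_vecSign_mul_vecSign hr hri hi (by omega), mul_assoc]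


lemma mem_admissible {D i j t : ℕ} : t ∈ admissible D i j ↔ (i, j, t) ∈ index D := by
  simp only [admissible, index, mem_filter, mem_range, mem_product]
  omega

/-- For `D ≥ 3` the condition `i + j - t ≤ 2D - 2` follows from the others, and the floors amount to
`b ≤ 2 * t` and `a ≤ 2 * t`. -/
lemma mem_index {D a b t : ℕ} (hD : 3 ≤ D) : (a, b, t) ∈ index D ↔ t ≤ a ∧ t ≤ b ∧ a ≤ D ∧ b ≤ D ∧
    (a = D → b ≤ 2 * t) ∧ (b = D → a ≤ 2 * t) := by
  simp only [index, mem_filter, mem_range, mem_product]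
  constructor
  · rintro ⟨⟨h1, h2, h3⟩, h4, h5, h6, h7, h8⟩
    exact ⟨h4, h5, by omega, by omega, fun h => by have := h7 h; omega,
      fun h => by have := h8 h; omega⟩
  · rintro ⟨h1, h2, h3, h4, h5, h6⟩
    refine ⟨⟨by omega, by omega, by omega⟩, h1, h2, ?_, fun h => by have := h5 h; omega,
      fun h => by have := h6 h; omega⟩
    rcases h3.lt_or_eq with h | h
    · rcases h4.lt_or_eq with h' | h'
      · omega
      · have := h6 h'; omega
    · have := h5 h; omega

lemma admissible_eq_range {D i j : ℕ} (hD : 3 ≤ D) (hi : i < D) (hj : j < D) :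
    admissible D i j = range (min i j + 1) := by
  ext t
  rw [mem_admissible, mem_index hD, mem_range, Nat.lt_succ_iff, le_min_iff]
  exact ⟨fun h => ⟨h.1, h.2.1⟩, fun h => ⟨h.1, h.2, hi.le, hj.le, fun h => absurd h hi.ne,
    fun h => absurd h hj.ne⟩⟩

lemma admissible_right {D i : ℕ} (hD : 3 ≤ D) (hi : i ≤ D) :
    admissible D i D = (range (i + 1)).filter fun t => (i + 1) / 2 ≤ t := by
  ext t
  rw [mem_admissible, mem_index hD, mem_filter, mem_range]
  constructor
  · rintro ⟨h1, -, -, -, -, h2⟩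
    have := h2 rfl
    omega
  · rintro ⟨h1, h2⟩
    exact ⟨by omega, by omega, hi, le_rfl, fun h => by omega, fun _ => by omega⟩

lemma admissible_left {D j : ℕ} (hD : 3 ≤ D) (hj : j ≤ D) :
    admissible D D j = (range (j + 1)).filter fun t => (j + 1) / 2 ≤ t := by
  rw [← admissible_right hD hj]
  ext t
  rw [mem_admissible, mem_admissible, mem_index hD, mem_index hD]
  tauto

lemma tie_right {D i t : ℕ} : tie D i D t = if 2 * t = i then 1 / 2 else 1 :=
  if_congr (by omega) rfl rfl

lemma tie_left {D j t : ℕ} : tie D D j t = if 2 * t = j then 1 / 2 else 1 :=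
  if_congr (by omega) rfl rfl

/-- A block of coefficients `β^r_{i,j,t}` weighted by the values of a kernel which is invariant
under permutations and complements is a restriction of the kernel to the span of `pairSign r`
on the sets of size `i` and `j`. -/
lemma sum_beta_eq {D r i j : ℕ} (hD : 3 ≤ D) (hr : r < D) (hri : r ≤ i)
    (hi : i ≤ D) (hj : j ≤ D) (hpar : Even r ∨ (i < D ∧ j < D))
    {K : Finset (Fin (2 * D)) → Finset (Fin (2 * D)) → ℝ} {y : ℕ → ℕ → ℕ → ℝ}
    (hK : ∀ u v, (#u, #v, #(u ∩ v)) ∈ index D → K u v = y #u #v #(u ∩ v))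
    (hl : ∀ u v, K uᶜ v = K u v) (hr' : ∀ u v, K u vᶜ = K u v) :
    2 ^ r * ∑ t ∈ admissible D i j, beta D r i j t * y i j t =
      ∑ u : Finset (Fin (2 * D)), ∑ v : Finset (Fin (2 * D)),
        (if #u = i ∧ #v = j then vecSign r u * vecSign r v * K u v else 0) := by
  have hint : ∀ u v : Finset (Fin (2 * D)), #(u ∩ v) ≤ #u ∧ #(u ∩ v) ≤ #v := fun u v =>
    ⟨card_le_card inter_subset_left, card_le_card inter_subset_right⟩
  have hidx := fun a b t => mem_index (a := a) (b := b) (t := t) hD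
  have hcl : ∀ u v : Finset (Fin (2 * D)), #u = D → #(uᶜ ∩ v) = #v - #(u ∩ v) ∧ #uᶜ = D := by
    intro u v hu
    refine ⟨?_, by rw [card_compl, hu, Fintype.card_fin]; omega⟩
    have := card_sdiff_add_card_inter v u
    rw [show uᶜ ∩ v = v \ u by ext; simp [and_comm], inter_comm u v]
    omega
  have hcr : ∀ u v : Finset (Fin (2 * D)), #v = D → #(u ∩ vᶜ) = #u - #(u ∩ v) ∧ #vᶜ = D := by
    intro u v hv
    have := hcl v u hv
    rwa [inter_comm, inter_comm u v]
  rcases hi.lt_or_eq with hi' | rfl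
  · rcases hj.lt_or_eq with hj' | rfl
    · rw [sum_vecSign_kernel (y := y i j) hr hri hi]
      · congr 1
        refine sum_congr (admissible_eq_range hD hi' hj') fun t _ => ?_
        · rw [beta, if_pos hi', if_pos hj', betaInner, eigenvalue]
      · rintro u v rfl rfl
        exact hK u v ((hidx _ _ _).2 ⟨(hint u v).1, (hint u v).2, by omega⟩)
    -- Complementing the `D`-set `v` turns intersection size `s` into `i - s`; only the larger of
    -- the two is an index of a variable.
    · rw [sum_vecSign_kernel (y := fun s => y i j (max s (i - s))) hr hri hi, min_eq_left hi,
        sum_range_fold]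
      · congr 1
        refine sum_congr (admissible_right hD hi) fun t ht => ?_
        · have ht := (hidx _ _ _).1 (mem_admissible.1 ((admissible_right hD hi).symm ▸ ht))
          rw [beta, if_pos hi', if_neg (lt_irrefl _), betaCol_eq ht.1, tie_right]
          push_cast
          ring
      · rintro u v rfl hv
        obtain ⟨h1, h2⟩ := hint u v
        rcases le_total #u (2 * #(u ∩ v)) with h | h
        · rw [max_eq_left (by omega), hK u v ((hidx _ _ _).2 ⟨by omega, by omega, by omega, by omega, by omega, by omega⟩), hv]
        · obtain ⟨h3, h4⟩ := hcr u v hv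
          rw [max_eq_right (by omega), ← hr', hK u vᶜ ((hidx _ _ _).2 ⟨by omega, by omega, by omega, by omega, by omega, by omega⟩), h3, h4]
  · have he : Even r := by
      rcases hpar with h | h
      · exact h
      · exact absurd h.1 (lt_irrefl _)
    have key : ∀ u v : Finset (Fin (2 * i)), #u = i → #v = j →
        K u v = y i j (max #(u ∩ v) (j - #(u ∩ v))) := by
      rintro u v hu rfl
      obtain ⟨h1, h2⟩ := hint u v
      rcases le_total #v (2 * #(u ∩ v)) with h | h
      · rw [max_eq_left (by omega), hK u v ((hidx _ _ _).2 ⟨by omega, by omega, by omega, by omega, by omega, by omega⟩), hu]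
      · obtain ⟨h3, h4⟩ := hcl u v hu
        rw [max_eq_right (by omega), ← hl, hK uᶜ v ((hidx _ _ _).2 ⟨by omega, by omega, by omega, by omega, by omega, by omega⟩), h3, h4]
    rw [sum_vecSign_kernel (y := fun s => y i j (max s (j - s))) hr hri hi key, min_eq_right hj,
      sum_range_fold]
    congr 1
    refine sum_congr (admissible_left hD hj) fun t ht => ?_
    · have ht := (hidx _ _ _).1 (mem_admissible.1 ((admissible_left hD hj).symm ▸ ht))
      rcases hj.lt_or_eq with hj' | rfl
      · rw [beta, if_neg (lt_irrefl _), if_pos hj', betaRow_eq hr he ht.2.1, tie_left]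
        push_cast
        ring
      · rw [beta, if_neg (lt_irrefl _), if_neg (lt_irrefl _), betaCorner_eq hr he ht.2.1, tie_left]
        push_cast
        ring

lemma posSemidef_sum_beta {D r m : ℕ} (hD : 3 ≤ D) (hr : r < D) (hm : m ≤ D)
    (he : Even r ∨ m < D)
    {K : Finset (Fin (2 * D)) → Finset (Fin (2 * D)) → ℝ} {y : ℕ → ℕ → ℕ → ℝ}
    (hK : ∀ u v, (#u, #v, #(u ∩ v)) ∈ index D → K u v = y #u #v #(u ∩ v))
    (hl : ∀ u v, K uᶜ v = K u v) (hr' : ∀ u v, K u vᶜ = K u v)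
    (hpos : (Matrix.of K).PosSemidef) :
    (Matrix.of fun i j : Icc r m =>
      ∑ t ∈ admissible D i j, beta D r i j t * y i j t).PosSemidef := by
  -- Column `i` is the test vector supported on `i`-sets; the block is `(2 ^ r)⁻¹ • Wᴴ K W`.
  let W : Matrix (Finset (Fin (2 * D))) (Icc r m) ℝ :=
    Matrix.of fun u i => if #u = i then vecSign r u else 0
  have h := (hpos.conjTranspose_mul_mul_same W).smul (a := ((2 : ℝ) ^ r)⁻¹) (by positivity)
  convert h using 1
  ext i j
  have hi := mem_Icc.1 i.2
  have hj := mem_Icc.1 j.2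
  have e := sum_beta_eq hD hr hi.1 (hi.2.trans hm) (hj.2.trans hm)
    (he.imp_right fun h => ⟨by omega, by omega⟩) hK hl hr'
  rw [Matrix.smul_apply, smul_eq_mul, eq_inv_mul_iff_mul_eq₀ (by positivity), Matrix.of_apply, e,
    Matrix.mul_apply, sum_comm]
  refine sum_congr rfl fun v _ => ?_
  rw [Matrix.mul_apply, sum_mul]
  refine sum_congr rfl fun u _ => ?_
  simp only [Matrix.conjTranspose_apply, Matrix.of_apply, W, star_trivial]
  by_cases h1 : #u = i <;> by_cases h2 : #v = j <;> simp [h1, h2]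
  ring

/-! ### Correlations of a family of sets -/

lemma symmDiff_empty_right {α : Type*} [DecidableEq α] (c : Finset α) : c ∆ ∅ = c :=
  symmDiff_bot c

lemma map_perm_symmDiff {α : Type*} [DecidableEq α] (σ : Equiv.Perm α) (u v : Finset α) :
    (u ∆ v).map σ.toEmbedding = u.map σ.toEmbedding ∆ v.map σ.toEmbedding := by
  ext y
  obtain ⟨x, rfl⟩ := σ.surjective y
  simp [mem_symmDiff]

lemma card_symmDiff_add {α : Type*} [DecidableEq α] (u v : Finset α) :
    #(u ∆ v) + 2 * #(u ∩ v) = #u + #v := by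
  have h1 := card_sdiff_add_card_inter u v
  have h2 := card_sdiff_add_card_inter v u
  rw [inter_comm v u] at h2
  have h3 : #(u ∆ v) = #(u \ v) + #(v \ u) := by
    rw [symmDiff_def]
    exact card_union_of_disjoint disjoint_sdiff_sdiff
  omega

section Correlation

variable {α : Type*} [Fintype α] [DecidableEq α]

/-- The three cardinalities determine the sizes of the four cells cut out by the two sets, so the
cells can be matched by bijections and glued. -/
lemma exists_perm_map_eq {u v u' v' : Finset α} (hu : #u = #u') (hv : #v = #v')
    (huv : #(u ∩ v) = #(u' ∩ v')) :
    ∃ σ : Equiv.Perm α, u.map σ.toEmbedding = u' ∧ v.map σ.toEmbedding = v' := by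
  have card_fiber : ∀ (u v : Finset α) (c : Bool × Bool),
      Fintype.card {x // (decide (x ∈ u), decide (x ∈ v)) = c} =
        match c with
        | (true, true) => #(u ∩ v)
        | (true, false) => #u - #(u ∩ v)
        | (false, true) => #v - #(u ∩ v)
        | (false, false) => Fintype.card α - (#u + #v - #(u ∩ v)) := by
    intro u v c
    rw [Fintype.card_subtype]
    rcases c with ⟨_ | _, _ | _⟩ <;> dsimp only
    · rw [← card_union, ← card_compl]
      congr 1; ext x; simp
    · rw [← card_sdiff]
      congr 1; ext x; simp [and_comm]
    · rw [inter_comm, ← card_sdiff]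
      congr 1; ext x; simp
    · congr 1; ext x; simp
  let e : ∀ c : Bool × Bool, {x // (decide (x ∈ u), decide (x ∈ v)) = c} ≃
      {x // (decide (x ∈ u'), decide (x ∈ v')) = c} := fun c =>
    Fintype.equivOfCardEq (by rw [card_fiber, card_fiber, hu, hv, huv])
  obtain ⟨σ, h⟩ : ∃ σ : Equiv.Perm α, ∀ x, (σ x ∈ u' ↔ x ∈ u) ∧ (σ x ∈ v' ↔ x ∈ v) :=
    ⟨Equiv.ofFiberEquiv e, fun x => by
      simpa only [decide_eq_decide] using Prod.ext_iff.1 (Equiv.ofFiberEquiv_map e x)⟩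
  refine ⟨σ, ?_, ?_⟩
  · ext y
    obtain ⟨x, rfl⟩ := σ.surjective y
    rw [(h x).1]
    simp
  · ext y
    obtain ⟨x, rfl⟩ := σ.surjective y
    rw [(h x).2]
    simp

lemma map_perm_compl (σ : Equiv.Perm α) (u : Finset α) :
    uᶜ.map σ.toEmbedding = (u.map σ.toEmbedding)ᶜ := by
  ext y
  obtain ⟨x, rfl⟩ := σ.surjective y
  simp

lemma symmDiff_compl_eq (u v : Finset α) : u ∆ vᶜ = (u ∆ v)ᶜ := by
  ext x
  simp only [mem_symmDiff, mem_compl]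
  tauto

/-- The number of pairs of a permutation `σ` and a centre `c ∈ E` such that the translates of
`σ u` and `σ v` by `c` lie in `A`. -/
def corr (A E : Finset (Finset α)) (u v : Finset α) : ℝ :=
  ∑ σ : Equiv.Perm α, ∑ c ∈ E,
    if c ∆ u.map σ.toEmbedding ∈ A ∧ c ∆ v.map σ.toEmbedding ∈ A then 1 else 0

variable {A E : Finset (Finset α)} {u v : Finset α}

lemma corr_comm : corr A E u v = corr A E v u := by
  simp only [corr, and_comm]

lemma corr_map (τ : Equiv.Perm α) :
    corr A E (u.map τ.toEmbedding) (v.map τ.toEmbedding) = corr A E u v := by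
  refine Fintype.sum_equiv (Equiv.mulRight τ) _ _ fun σ => ?_
  simp only [map_map]
  rfl

lemma corr_congr {u' v' : Finset α} (hu : #u = #u') (hv : #v = #v')
    (huv : #(u ∩ v) = #(u' ∩ v')) : corr A E u v = corr A E u' v' := by
  obtain ⟨σ, rfl, rfl⟩ := exists_perm_map_eq hu hv huv
  rw [corr_map]

lemma corr_congr_symmDiff {u' v' : Finset α} (hu : #u = #u') (hv : #v = #v')
    (huv : #(u ∆ v) = #(u' ∆ v')) : corr A E u v = corr A E u' v' := by
  refine corr_congr hu hv ?_
  have h1 := card_symmDiff_add u v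
  have h2 := card_symmDiff_add u' v'
  omega

lemma corr_compl_left (hA : ∀ c, cᶜ ∈ A ↔ c ∈ A) : corr A E uᶜ v = corr A E u v := by
  simp only [corr, map_perm_compl, symmDiff_compl_eq, hA]

lemma corr_compl_right (hA : ∀ c, cᶜ ∈ A ↔ c ∈ A) : corr A E u vᶜ = corr A E u v := by
  rw [corr_comm, corr_compl_left hA, corr_comm]

/-- Take `c ∆ σu`, which lies in `A`, as the new centre; the old centre was unrestricted, so the
only other condition is on the translate by `σ(u ∆ v)`. -/
lemma corr_univ : corr A univ u v = corr A A (u ∆ v) ∅ := by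
  refine sum_congr rfl fun σ _ => ?_
  rw [← sum_filter, ← sum_filter, sum_const, sum_const]
  congr 1
  refine card_bij' (fun c _ => c ∆ u.map σ.toEmbedding) (fun c _ => c ∆ u.map σ.toEmbedding)
    ?_ ?_ ?_ ?_
  · intro c hc
    have hc := (mem_filter.1 hc).2
    simp only [mem_filter, map_empty, map_perm_symmDiff]
    rw [show (c ∆ u.map σ.toEmbedding) ∆ (u.map σ.toEmbedding ∆ v.map σ.toEmbedding) =
      c ∆ v.map σ.toEmbedding by rw [symmDiff_assoc, symmDiff_symmDiff_cancel_left]]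
    exact ⟨hc.1, hc.2, by simpa [symmDiff_empty_right] using hc.1⟩
  · intro c hc
    have hc := mem_filter.1 hc
    simp only [map_perm_symmDiff] at hc
    simp only [mem_filter, mem_univ, true_and, symmDiff_symmDiff_cancel_right]
    exact ⟨hc.1, by rw [symmDiff_assoc]; exact hc.2.1⟩
  · intro c _
    exact symmDiff_symmDiff_cancel_right _ _
  · intro c _
    exact symmDiff_symmDiff_cancel_right _ _

/-- The count concerns triples `c`, `c ∆ σu`, `c ∆ σv` in `A`; the same recentring exchanges the
first two. -/
lemma corr_symmDiff : corr A A u v = corr A A u (u ∆ v) := by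
  refine sum_congr rfl fun σ _ => ?_
  rw [← sum_filter, ← sum_filter, sum_const, sum_const]
  congr 1
  refine card_bij' (fun c _ => c ∆ u.map σ.toEmbedding) (fun c _ => c ∆ u.map σ.toEmbedding)
    ?_ ?_ ?_ ?_
  · intro c hc
    have hc := mem_filter.1 hc
    simp only [mem_filter, map_perm_symmDiff, symmDiff_symmDiff_cancel_right]
    rw [show (c ∆ u.map σ.toEmbedding) ∆ (u.map σ.toEmbedding ∆ v.map σ.toEmbedding) =
      c ∆ v.map σ.toEmbedding by rw [symmDiff_assoc, symmDiff_symmDiff_cancel_left]]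
    exact ⟨hc.2.1, hc.1, hc.2.2⟩
  · intro c hc
    have hc := mem_filter.1 hc
    simp only [map_perm_symmDiff] at hc
    simp only [mem_filter, symmDiff_symmDiff_cancel_right]
    exact ⟨hc.2.1, hc.1, by rw [symmDiff_assoc]; exact hc.2.2⟩
  · intro c _
    exact symmDiff_symmDiff_cancel_right _ _
  · intro c _
    exact symmDiff_symmDiff_cancel_right _ _

lemma corr_add_corr_compl : corr A E u v + corr A Eᶜ u v = corr A univ u v := by
  rw [corr, corr, corr, ← sum_add_distrib]
  exact sum_congr rfl fun σ _ => sum_add_sum_compl _ _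

lemma corr_nonneg : 0 ≤ corr A E u v :=
  sum_nonneg fun _ _ => sum_nonneg fun _ _ => by split_ifs <;> norm_num

lemma corr_le : corr A A u v ≤ corr A A u ∅ := by
  refine sum_le_sum fun σ _ => sum_le_sum fun c hc => ?_
  by_cases h : c ∆ u.map σ.toEmbedding ∈ A
  · have : c ∆ (∅ : Finset α).map σ.toEmbedding ∈ A := by simpa [symmDiff_empty_right] using hc
    rw [if_pos (show _ ∧ _ from ⟨h, this⟩)]
    split_ifs <;> norm_num
  · rw [if_neg (by tauto), if_neg (by tauto)]

lemma corr_empty : corr A A ∅ ∅ = (Fintype.card (Equiv.Perm α) : ℝ) * #A := by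
  rw [corr, sum_congr rfl fun σ _ => show _ = (#A : ℝ) from ?_]
  · simp
  · rw [sum_congr rfl fun c hc => if_pos (by simpa [symmDiff_empty_right] using hc)]
    simp

lemma sum_corr_empty :
    ∑ u, corr A A u ∅ = (Fintype.card (Equiv.Perm α) : ℝ) * (#A * #A) := by
  simp only [corr]
  rw [sum_comm, sum_congr rfl fun σ _ => show _ = ((#A * #A : ℕ) : ℝ) from ?_]
  · simp
  · rw [sum_comm, sum_congr rfl fun c hc => show _ = (#A : ℝ) from ?_]
    · simp
    · have : ∀ u : Finset α, (c ∆ u.map σ.toEmbedding ∈ A ∧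
          c ∆ (∅ : Finset α).map σ.toEmbedding ∈ A) ↔ c ∆ u.map σ.toEmbedding ∈ A := by
        intro u
        simp [hc, symmDiff_empty_right]
      simp only [this]
      rw [← sum_filter, sum_const, nsmul_eq_mul, mul_one]
      congr 1
      refine card_bij (fun u _ => c ∆ u.map σ.toEmbedding) ?_ ?_ ?_
      · intro u hu
        exact (mem_filter.1 hu).2
      · intro u _ w _ h
        exact map_injective _ (symmDiff_right_injective c h)
      · intro a ha
        refine ⟨(c ∆ a).map σ.symm.toEmbedding, ?_, ?_⟩ <;>
          simp [map_map, ha]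

/-- A Gram matrix: row `u` is the indicator vector of the pairs `(σ, c)` with `c ∆ σu ∈ A`. -/
lemma corr_posSemidef : (Matrix.of (corr A E)).PosSemidef := by
  let W : Matrix (Finset α) (Equiv.Perm α × E) ℝ :=
    Matrix.of fun u p => if p.2.1 ∆ u.map p.1.toEmbedding ∈ A then 1 else 0
  convert Matrix.posSemidef_self_mul_conjTranspose W
  ext u v
  rw [Matrix.mul_apply, Fintype.sum_prod_type, Matrix.of_apply, corr]
  refine sum_congr rfl fun σ _ => ?_
  rw [← sum_coe_sort E]
  refine sum_congr rfl fun c _ => ?_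
  simp only [W, ← ite_and, Matrix.of_apply, Matrix.conjTranspose_apply, star_trivial, mul_ite, mul_one,
    mul_zero, and_comm]

end Correlation

/-! ### Permutation symmetry of the correlations -/

section Symmetry

variable {α : Type*} [Fintype α] [DecidableEq α] {A : Finset (Finset α)}

lemma perm_three {a b c a' b' c' : ℕ} (h : [a', b', c'].Perm [a, b, c]) :
    (a' = a ∧ b' = b ∧ c' = c) ∨ (a' = a ∧ b' = c ∧ c' = b) ∨ (a' = b ∧ b' = a ∧ c' = c) ∨
      (a' = b ∧ b' = c ∧ c' = a) ∨ (a' = c ∧ b' = a ∧ c' = b) ∨ (a' = c ∧ b' = b ∧ c' = a) := by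
  have pair : ∀ {x y x' y' : ℕ}, [x', y'].Perm [x, y] → (x' = x ∧ y' = y) ∨ (x' = y ∧ y' = x) := by
    intro x y x' y' h
    have h1 : x' = x ∨ x' = y := by simpa using h.subset (List.mem_cons_self)
    rcases h1 with rfl | rfl
    · exact Or.inl ⟨rfl, by simpa using h⟩
    · exact Or.inr ⟨rfl, by simpa using h.trans (List.Perm.swap _ _ _)⟩
  have h1 : a' = a ∨ a' = b ∨ a' = c := by simpa using h.subset (List.mem_cons_self)
  rcases h1 with rfl | rfl | rfl
  · rcases pair ((List.perm_cons _).1 h) with ⟨rfl, rfl⟩ | ⟨rfl, rfl⟩ <;> simp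
  · rcases pair ((List.perm_cons _).1 (h.trans (List.Perm.swap _ _ _))) with
      ⟨rfl, rfl⟩ | ⟨rfl, rfl⟩ <;> simp
  · have h2 : [a, b, a'].Perm [a', a, b] :=
      ((List.Perm.swap a' b []).cons a).trans (List.Perm.swap a' a [b])
    rcases pair ((List.perm_cons _).1 (h.trans h2)) with ⟨rfl, rfl⟩ | ⟨rfl, rfl⟩ <;> simp

/-- Swapping `u`, `v` and replacing `v` by `f (u ∆ v)` generate all permutations of the three sizes.
The map `f` covers both permutation constraints: the identity for the low range, complementation for
the high range. -/
lemma corr_eq_of_perm {f : Finset α → Finset α} (hf : ∀ s t, s ∆ f t = f (s ∆ t))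
    (hff : ∀ s, f (f s) = s) (hcard : ∀ s t, #(f s) = #(f t) → #s = #t)
    (hcorr : ∀ u s, corr A A u (f s) = corr A A u s) {u v u' v' : Finset α}
    (h : [#u', #v', #(f (u' ∆ v'))].Perm [#u, #v, #(f (u ∆ v))]) :
    corr A A u v = corr A A u' v' := by
  have hcard' : ∀ s t, #s = #t → #(f s) = #(f t) := fun s t h =>
    hcard _ _ (by rwa [hff, hff])
  have step : ∀ a b, corr A A a b = corr A A a (f (a ∆ b)) := fun a b => by
    rw [hcorr, ← corr_symmDiff]
  have e1 : u ∆ f (u ∆ v) = f v := by rw [hf, symmDiff_symmDiff_cancel_left]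
  have e2 : v ∆ f (u ∆ v) = f u := by rw [hf, symmDiff_comm u, symmDiff_symmDiff_cancel_left]
  rcases perm_three h with ⟨h1, h2, h3⟩ | ⟨h1, h2, h3⟩ | ⟨h1, h2, h3⟩ | ⟨h1, h2, h3⟩ |
      ⟨h1, h2, h3⟩ | ⟨h1, h2, h3⟩
  · exact corr_congr_symmDiff h1.symm h2.symm (hcard _ _ h3.symm)
  · rw [step u v]
    refine corr_congr_symmDiff h1.symm h2.symm ?_
    rw [e1]
    exact hcard _ _ (by rw [hff, h3])
  · rw [corr_comm]
    refine corr_congr_symmDiff h1.symm h2.symm ?_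
    rw [symmDiff_comm]
    exact hcard _ _ h3.symm
  · rw [corr_comm, step v u, symmDiff_comm v u]
    refine corr_congr_symmDiff h1.symm h2.symm ?_
    rw [e2]
    exact hcard _ _ (by rw [hff, h3])
  · rw [step u v, corr_comm]
    refine corr_congr_symmDiff h1.symm h2.symm ?_
    rw [symmDiff_comm, e1]
    exact hcard _ _ (by rw [hff, h3])
  · rw [corr_comm, step v u, symmDiff_comm v u, corr_comm]
    refine corr_congr_symmDiff h1.symm h2.symm ?_
    rw [symmDiff_comm, e2]
    exact hcard _ _ (by rw [hff, h3])

lemma exists_card_inter {i j t : ℕ} (hi : t ≤ i) (hj : t ≤ j) (h : i + j ≤ Fintype.card α + t) :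
    ∃ u v : Finset α, #u = i ∧ #v = j ∧ #(u ∩ v) = t := by
  obtain ⟨u, -, hu⟩ := exists_subset_card_eq (s := (univ : Finset α)) (n := i)
    (by rw [card_univ]; omega)
  obtain ⟨w, hw, hwt⟩ := exists_subset_card_eq (s := u) (n := t) (by omega)
  obtain ⟨w', hw', hwt'⟩ := exists_subset_card_eq (s := uᶜ) (n := j - t) (by rw [card_compl]; omega)
  have hd : Disjoint u w' := disjoint_compl_right.mono_right hw'
  refine ⟨u, w ∪ w', hu, ?_, ?_⟩
  · rw [card_union_of_disjoint (hd.mono_left hw)]; omega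
  · rw [inter_union_distrib_left, inter_eq_right.2 hw, disjoint_iff_inter_eq_empty.1 hd,
      union_empty, hwt]

end Symmetry

/-! ### Lifting a code to a complement-closed family -/

section Lift

/-- The vertex of the folded cube given by a set. -/
def toVertex {n : ℕ} (u : Finset (Fin n)) : Vertex n := ⟨s(u, uᶜ), u, rfl⟩

variable {n : ℕ}

lemma toVertex_eq_iff {u v : Finset (Fin n)} : toVertex u = toVertex v ↔ u = v ∨ u = vᶜ := by
  rw [toVertex, toVertex, Subtype.mk_eq_mk, Sym2.eq_iff]
  constructor
  · rintro (h | h)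
    · exact Or.inl h.1
    · exact Or.inr h.1
  · rintro (rfl | rfl)
    · exact Or.inl ⟨rfl, rfl⟩
    · exact Or.inr ⟨rfl, compl_compl _⟩

lemma toVertex_compl (u : Finset (Fin n)) : toVertex uᶜ = toVertex u :=
  toVertex_eq_iff.2 (Or.inr rfl)

/-- Flip the elements of `u ∆ v` one at a time. Only this upper bound on the distance is needed: a
code distance of at least `d` then forces `#(u ∆ v)` to be at least `d`. -/
lemma exists_walk_length_le (hn : 2 ≤ n) (u v : Finset (Fin n)) :
    ∃ p : (graph n).Walk (toVertex u) (toVertex v), p.length ≤ #(u ∆ v) := by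
  obtain ⟨k, hk⟩ : ∃ k, #(u ∆ v) = k := ⟨_, rfl⟩
  induction k generalizing u with
  | zero =>
    obtain rfl : u = v := symmDiff_eq_bot.1 (card_eq_zero.1 hk)
    exact ⟨.nil, by simp⟩
  | succ k ih =>
    obtain ⟨a, ha⟩ : (u ∆ v).Nonempty := card_pos.1 (by omega)
    have h1 : #((u ∆ {a}) ∆ v) = k := by
      rw [symmDiff_right_comm, symmDiff_comm, symmDiff_def, sdiff_eq_bot_iff.2 (by simpa using ha),
        bot_sup_eq, card_sdiff_of_subset (by simpa using ha), hk]
      simp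
    obtain ⟨p, hp⟩ := ih _ h1
    have h2 : u ∆ (u ∆ {a}) = {a} := symmDiff_symmDiff_cancel_left _ _
    have hadj : (graph n).Adj (toVertex u) (toVertex (u ∆ {a})) := by
      refine ⟨?_, u, Sym2.mem_mk_left _ _, u ∆ {a}, Sym2.mem_mk_left _ _, by rw [h2]; simp⟩
      rw [Ne, toVertex_eq_iff]
      rintro (h | h)
      · rw [← h, symmDiff_self] at h2
        exact absurd (congrArg card h2) (by simp)
      -- A single flip cannot give the complement, since `u` and `uᶜ` differ in `n ≥ 2` elements.
      · have h3 := congrArg (u ∆ ·) h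
        simp only [symmDiff_compl_eq, symmDiff_self, h2] at h3
        have := congrArg card h3
        simp [card_compl] at this
        omega
    exact ⟨.cons hadj p, by rw [SimpleGraph.Walk.length_cons, hk]; omega⟩

lemma dist_toVertex_le (hn : 2 ≤ n) (u v : Finset (Fin n)) :
    (graph n).dist (toVertex u) (toVertex v) ≤ #(u ∆ v) := by
  obtain ⟨p, hp⟩ := exists_walk_length_le hn u v
  exact (SimpleGraph.dist_le p).trans hp

/-- The members of the vertices in `C`. -/
noncomputable def lift (C : Finset (Vertex n)) : Finset (Finset (Fin n)) := by
  classical exact univ.filter fun u => toVertex u ∈ C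

variable {C : Finset (Vertex n)}

lemma mem_lift {u : Finset (Fin n)} : u ∈ lift C ↔ toVertex u ∈ C := by
  simp [lift]

lemma compl_mem_lift (u : Finset (Fin n)) : uᶜ ∈ lift C ↔ u ∈ lift C := by
  rw [mem_lift, mem_lift, toVertex_compl]

lemma card_lift (hn : 0 < n) : #(lift C) = 2 * #C := by
  classical
  rw [card_eq_sum_card_fiberwise (f := toVertex) (t := C) fun u hu => mem_lift.1 hu,
    sum_const_nat (m := 2), mul_comm]
  rintro ⟨_, u, rfl⟩ hx
  have : (lift C).filter (fun v => toVertex v = ⟨s(u, uᶜ), u, rfl⟩) = {u, uᶜ} := by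
    ext v
    rw [mem_filter, mem_insert, mem_singleton, mem_lift]
    change _ ∧ toVertex v = toVertex u ↔ _
    rw [← toVertex_eq_iff]
    exact ⟨fun h => h.2, fun h => ⟨h ▸ hx, h⟩⟩
  rw [this, card_pair]
  intro h
  have := congrArg (⟨0, hn⟩ ∈ ·) h
  simp at this

lemma le_card_symmDiff {d : ℕ} (hn : 2 ≤ n) (hC : IsCode (graph n) d C) {u v : Finset (Fin n)}
    (hu : u ∈ lift C) (hv : v ∈ lift C) (h0 : #(u ∆ v) ≠ 0) (h1 : #(u ∆ v) ≠ n) :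
    d ≤ #(u ∆ v) := by
  refine (hC.2 _ (mem_lift.1 hu) _ (mem_lift.1 hv) ?_).trans (dist_toVertex_le hn u v)
  rw [Ne, toVertex_eq_iff]
  rintro (rfl | rfl)
  · simp at h0
  · rw [symmDiff_comm, symmDiff_compl_eq, symmDiff_self] at h1
    simp at h1

/-- A counted triple has pairwise differences of sizes `#u`, `#v`, `#(u ∆ v)`, and complementing one
member adds `n - #(u ∆ v)`; a code allows none of these strictly between `0` and `min n d`. -/
lemma corr_eq_zero {d : ℕ} (hn : 2 ≤ n) (hC : IsCode (graph n) d C) {u v : Finset (Fin n)}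
    (h : ∃ k, (k = #u ∨ k = #v ∨ k = #(u ∆ v) ∨ k = n - #(u ∆ v)) ∧ k ≠ 0 ∧ k < n ∧ k < d) :
    corr (lift C) (lift C) u v = 0 := by
  obtain ⟨k, hk, h0, h1, h2⟩ := h
  refine sum_eq_zero fun σ _ => sum_eq_zero fun c hc => if_neg ?_
  rintro ⟨hu, hv⟩
  have key : ∀ {a b}, a ∈ lift C → b ∈ lift C → #(a ∆ b) = k → False := fun ha hb hab => by
    have := le_card_symmDiff hn hC ha hb (by omega) (by omega)
    omega
  have hw : (c ∆ u.map σ.toEmbedding) ∆ (c ∆ v.map σ.toEmbedding) =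
      (u ∆ v).map σ.toEmbedding := by
    rw [symmDiff_symmDiff_symmDiff_comm, symmDiff_self, bot_symmDiff, map_perm_symmDiff]
  rcases hk with hk | hk | hk | hk
  · exact key hc hu (by rw [symmDiff_symmDiff_cancel_left, card_map, hk])
  · exact key hc hv (by rw [symmDiff_symmDiff_cancel_left, card_map, hk])
  · exact key hu hv (by rw [hw, card_map, hk])
  · refine key hu ((compl_mem_lift _).2 hv) ?_
    rw [symmDiff_compl_eq, hw, card_compl, card_map, Fintype.card_fin, hk]

end Lift

/-! ### Compactness of the feasible set -/

lemma isClosed_posSemidef {m : Type*} [Fintype m] :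
    IsClosed {M : Matrix m m ℝ | M.PosSemidef} := by
  simp only [Matrix.posSemidef_iff_dotProduct_mulVec, Matrix.IsHermitian, Set.ofPred_and,
    Set.ofPred_forall]
  refine IsClosed.inter (isClosed_eq (by fun_prop) continuous_id) (isClosed_iInter fun x => ?_)
  exact isClosed_le continuous_const (by fun_prop)

lemma continuous_val {D : ℕ} (i j t : ℕ) : Continuous fun x : Variables D => x.val i j t := by
  unfold Variables.val
  split_ifs
  · exact continuous_apply _
  · exact continuous_const

lemma continuous_block (D r m : ℕ) : Continuous (block D r m) := by
  refine continuous_matrix fun i j => ?_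
  simp only [block, Matrix.of_apply]
  refine continuous_finsetSum _ fun t _ => ?_
  exact continuous_const.mul (continuous_val _ _ _)

lemma continuous_coblock (D r m : ℕ) : Continuous (coblock D r m) := by
  refine continuous_matrix fun i j => ?_
  simp only [coblock, Matrix.of_apply]
  refine continuous_finsetSum _ fun t _ => ?_
  exact continuous_const.mul ((continuous_val _ _ _).sub (continuous_val _ _ _))

lemma continuous_objective (D : ℕ) : Continuous (objective D) := by
  refine (continuous_finsetSum _ fun i _ => ?_).add ?_ <;>
    exact continuous_const.mul (continuous_val _ _ _)

lemma isClosed_linearConstraints (D d : ℕ) : IsClosed {x : Variables D | LinearConstraints D d x} := by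
  have : {x : Variables D | LinearConstraints D d x} = {x | x.val 0 0 0 = 1 ∧
      (∀ i j t, (i, j, t) ∈ index D → 0 ≤ x.val i j t ∧ x.val i j t ≤ x.val i 0 0) ∧
      (∀ i j t i' j' t', (i, j, t) ∈ index D → (i', j', t') ∈ index D →
        i + j - 2 * t ≤ D → [i', j', i' + j' - 2 * t'].Perm [i, j, i + j - 2 * t] →
        x.val i j t = x.val i' j' t') ∧
      (∀ i j t i' j' t', (i, j, t) ∈ index D → (i', j', t') ∈ index D →
        D + 1 ≤ i + j - 2 * t → i + j - 2 * t ≤ 2 * D - 2 →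
        [i', j', 2 * D - (i' + j' - 2 * t')].Perm [i, j, 2 * D - (i + j - 2 * t)] →
        x.val i j t = x.val i' j' t') ∧
      (∀ i j t, (i, j, t) ∈ index D →
        (∃ k ∈ [i, j, i + j - 2 * t, 2 * D - (i + j - 2 * t)], 1 ≤ k ∧ k ≤ d - 1) →
        x.val i j t = 0)} := by
    ext x
    exact ⟨fun ⟨h1, h2, h3, h4, h5⟩ => ⟨h1, h2, h3, h4, h5⟩,
      fun ⟨h1, h2, h3, h4, h5⟩ => ⟨h1, h2, h3, h4, h5⟩⟩
  rw [this]
  simp only [Set.ofPred_and, Set.ofPred_forall]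
  refine (isClosed_eq (continuous_val _ _ _) continuous_const).inter (IsClosed.inter ?_
    (IsClosed.inter ?_ (IsClosed.inter ?_ ?_)))
  · exact isClosed_iInter fun i => isClosed_iInter fun j => isClosed_iInter fun t =>
      isClosed_iInter fun _ => (isClosed_le continuous_const (continuous_val _ _ _)).inter
        (isClosed_le (continuous_val _ _ _) (continuous_val _ _ _))
  · repeat refine isClosed_iInter fun _ => ?_
    exact isClosed_eq (continuous_val _ _ _) (continuous_val _ _ _)
  · repeat refine isClosed_iInter fun _ => ?_
    exact isClosed_eq (continuous_val _ _ _) (continuous_val _ _ _)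
  · repeat refine isClosed_iInter fun _ => ?_
    exact isClosed_eq (continuous_val _ _ _) continuous_const

lemma isClosed_feasible (D d : ℕ) : IsClosed {x : Variables D | Feasible D d x} := by
  have : {x : Variables D | Feasible D d x} = {x | LinearConstraints D d x ∧
      (∀ r, Even r → r ≤ D - 1 → (block D r D x).PosSemidef) ∧
      (∀ r, Odd r → r ≤ D - 2 → (block D r (D - 1) x).PosSemidef) ∧
      (∀ r, Even r → r ≤ D - 1 → (coblock D r D x).PosSemidef) ∧
      (∀ r, Odd r → r ≤ D - 2 → (coblock D r (D - 1) x).PosSemidef)} := by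
    ext x
    exact ⟨fun ⟨h1, h2, h3, h4, h5⟩ => ⟨h1, h2, h3, h4, h5⟩,
      fun ⟨h1, h2, h3, h4, h5⟩ => ⟨h1, h2, h3, h4, h5⟩⟩
  rw [this]
  simp only [Set.ofPred_and, Set.ofPred_forall]
  refine (isClosed_linearConstraints D d).inter (IsClosed.inter ?_ (IsClosed.inter ?_
    (IsClosed.inter ?_ ?_))) <;>
    refine isClosed_iInter fun r => isClosed_iInter fun _ => isClosed_iInter fun _ => ?_
  · exact isClosed_posSemidef.preimage (continuous_block _ _ _)
  · exact isClosed_posSemidef.preimage (continuous_block _ _ _)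
  · exact isClosed_posSemidef.preimage (continuous_coblock _ _ _)
  · exact isClosed_posSemidef.preimage (continuous_coblock _ _ _)

lemma LinearConstraints.val_le_one {D d : ℕ} (hD : 2 ≤ D) {x : Variables D}
    (hx : LinearConstraints D d x) {i j t : ℕ} (h : (i, j, t) ∈ index D) : x.val i j t ≤ 1 := by
  have hi : i ≤ D := by
    simp only [index, mem_filter, mem_product, mem_range] at h
    omega
  have h1 : (i, 0, 0) ∈ index D := by
    simp only [index, mem_filter, mem_product, mem_range]
    omega
  have h2 : (0, i, 0) ∈ index D := by
    simp only [index, mem_filter, mem_product, mem_range]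
    omega
  refine (hx.bounds i j t h).2.trans ?_
  -- The chain is `x^t_{i,j} ≤ x^0_{i,0} = x^0_{0,i} ≤ x^0_{0,0} = 1`.
  rw [hx.perm_low i 0 0 0 i 0 h1 h2 (by omega) (by simpa using List.Perm.swap _ _ _), ← hx.one]
  exact (hx.bounds 0 i 0 h2).2

lemma isCompact_feasible {D : ℕ} (hD : 2 ≤ D) (d : ℕ) :
    IsCompact {x : Variables D | Feasible D d x} := by
  refine (isCompact_Icc (a := (0 : Variables D)) (b := 1)).of_isClosed_subset
    (isClosed_feasible D d) fun x hx => ?_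
  have hval : ∀ p : index D, x p = x.val p.1.1 p.1.2.1 p.1.2.2 := by
    rintro ⟨⟨i, j, t⟩, h⟩
    simp [Variables.val, h]
  refine ⟨fun p => ?_, fun p => ?_⟩
  · rw [hval]
    exact (hx.toLinearConstraints.bounds _ _ _ p.2).1
  · rw [hval]
    exact hx.toLinearConstraints.val_le_one hD p.2

/-! ### The feasible point of a code and its objective value -/

section Value

variable {α : Type*} [Fintype α] [DecidableEq α] {A : Finset (Finset α)}

/-- The normalizing factor of the correlations of `A`. -/
noncomputable def corrMass (A : Finset (Finset α)) : ℝ :=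
  (Fintype.card (Equiv.Perm α) : ℝ) * #A

open scoped Classical in
/-- The normalized value of `corr A A u v` for sets of sizes `i`, `j` with intersection of
size `t`. -/
noncomputable def corrVal (A : Finset (Finset α)) (i j t : ℕ) : ℝ :=
  if h : ∃ p : Finset α × Finset α, #p.1 = i ∧ #p.2 = j ∧ #(p.1 ∩ p.2) = t then
    corr A A h.choose.1 h.choose.2 / corrMass A
  else 0

lemma corrVal_card (u v : Finset α) :
    corrVal A #u #v #(u ∩ v) = corr A A u v / corrMass A := by
  have h : ∃ p : Finset α × Finset α, #p.1 = #u ∧ #p.2 = #v ∧ #(p.1 ∩ p.2) = #(u ∩ v) :=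
    ⟨(u, v), rfl, rfl, rfl⟩
  have hc := h.choose_spec
  rw [corrVal, dif_pos h, corr_congr hc.1 hc.2.1 hc.2.2]

lemma corrVal_card_empty (u : Finset α) : corrVal A #u 0 0 = corr A A u ∅ / corrMass A := by
  have := corrVal_card (A := A) u ∅
  simpa using this

lemma corrMass_nonneg : 0 ≤ corrMass A := by unfold corrMass; positivity

lemma corrMass_pos (hA : A.Nonempty) : 0 < corrMass A := by
  have := card_pos.2 hA
  unfold corrMass
  positivity

/-- Each permutation contributes all ordered pairs of members of `A`, so the correlations with `∅`
total `n! * #A ^ 2`; group by set size and normalize. -/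
lemma sum_corrVal (hA : A.Nonempty) :
    ∑ i ∈ range (Fintype.card α + 1), ((Fintype.card α).choose i : ℝ) * corrVal A i 0 0 = #A := by
  have h := sum_powerset_apply_card (fun i => corrVal A i 0 0) (x := (univ : Finset α))
  simp only [powerset_univ, corrVal_card_empty, nsmul_eq_mul, card_univ] at h
  rw [← h, ← sum_div, sum_corr_empty, div_eq_iff (corrMass_pos hA).ne', corrMass]
  ring

end Value

variable {D d : ℕ}

/-- The point of the semidefinite program given by a code. -/
noncomputable def codePoint (C : Finset (Vertex (2 * D))) : Variables D :=
  fun p => corrVal (lift C) p.1.1 p.1.2.1 p.1.2.2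

lemma codePoint_val {C : Finset (Vertex (2 * D))} {i j t : ℕ} (h : (i, j, t) ∈ index D) :
    (codePoint C).val i j t = corrVal (lift C) i j t := by
  rw [Variables.val, dif_pos h, codePoint]

lemma exists_card_of_mem_index (hD : 3 ≤ D) {i j t : ℕ} (h : (i, j, t) ∈ index D) :
    ∃ u v : Finset (Fin (2 * D)), #u = i ∧ #v = j ∧ #(u ∩ v) = t := by
  have := (mem_index hD).1 h
  exact exists_card_inter this.1 this.2.1 (by rw [Fintype.card_fin]; omega)

lemma card_symmDiff_eq {α : Type*} [DecidableEq α] (u v : Finset α) :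
    #u + #v - 2 * #(u ∩ v) = #(u ∆ v) := by
  have := card_symmDiff_add u v
  omega

lemma mem_index_zero (hD : 3 ≤ D) {i : ℕ} (hi : i ≤ D) : (i, 0, 0) ∈ index D :=
  (mem_index hD).2 ⟨by omega, le_rfl, hi, by omega, by omega, by omega⟩

lemma lift_nonempty {C : Finset (Vertex (2 * D))} (hC : C.Nonempty) : (lift C).Nonempty := by
  obtain ⟨⟨_, u, rfl⟩, hu⟩ := hC
  exact ⟨u, mem_lift.2 hu⟩

lemma linearConstraints_codePoint (hD : 3 ≤ D) (hd : d ≤ 2 * D) {C : Finset (Vertex (2 * D))}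
    (hC : IsCode (graph (2 * D)) d C) : LinearConstraints D d (codePoint C) where
  one := by
    have h := corrVal_card (A := lift C) ∅ ∅
    rw [codePoint_val (mem_index_zero hD (Nat.zero_le _))]
    simp only [card_empty, inter_self] at h
    rw [h, corr_empty]
    exact div_self (corrMass_pos (lift_nonempty hC.1)).ne'
  bounds := by
    intro i j t h
    rw [codePoint_val h, codePoint_val (mem_index_zero hD ((mem_index hD).1 h).2.2.1)]
    obtain ⟨u, v, rfl, rfl, rfl⟩ := exists_card_of_mem_index hD h
    rw [corrVal_card, corrVal_card_empty]
    exact ⟨div_nonneg corr_nonneg corrMass_nonneg,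
      div_le_div_of_nonneg_right corr_le corrMass_nonneg⟩
  perm_low := by
    intro i j t i' j' t' h h' _ hp
    rw [codePoint_val h, codePoint_val h']
    obtain ⟨u, v, rfl, rfl, rfl⟩ := exists_card_of_mem_index hD h
    obtain ⟨u', v', rfl, rfl, rfl⟩ := exists_card_of_mem_index hD h'
    rw [card_symmDiff_eq, card_symmDiff_eq] at hp
    rw [corrVal_card, corrVal_card, corr_eq_of_perm (f := id) (fun _ _ => rfl) (fun _ => rfl)
      (fun _ _ h => h) (fun _ _ => rfl) hp]
  perm_high := by
    intro i j t i' j' t' h h' _ _ hp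
    rw [codePoint_val h, codePoint_val h']
    obtain ⟨u, v, rfl, rfl, rfl⟩ := exists_card_of_mem_index hD h
    obtain ⟨u', v', rfl, rfl, rfl⟩ := exists_card_of_mem_index hD h'
    have hcard : ∀ s : Finset (Fin (2 * D)), #sᶜ = 2 * D - #s := fun s => by
      rw [card_compl, Fintype.card_fin]
    rw [card_symmDiff_eq, card_symmDiff_eq, ← hcard, ← hcard] at hp
    rw [corrVal_card, corrVal_card, corr_eq_of_perm (f := compl) symmDiff_compl_eq compl_compl
      (fun s t h => ?_) (fun _ _ => corr_compl_right compl_mem_lift) hp]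
    have h1 := card_compl_add_card s
    have h2 := card_compl_add_card t
    omega
  zero := by
    rintro i j t h ⟨k, hk, hk1, hk2⟩
    rw [codePoint_val h]
    obtain ⟨u, v, rfl, rfl, rfl⟩ := exists_card_of_mem_index hD h
    rw [card_symmDiff_eq] at hk
    simp only [List.mem_cons, List.not_mem_nil, or_false] at hk
    rw [corrVal_card, corr_eq_zero (by omega) hC ⟨k, hk, by omega, by omega, by omega⟩, zero_div]

lemma block_codePoint_posSemidef (hD : 3 ≤ D) {r m : ℕ} (hr : r < D) (hm : m ≤ D)
    (he : Even r ∨ m < D) (C : Finset (Vertex (2 * D))) :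
    (block D r m (codePoint C)).PosSemidef := by
  have h := posSemidef_sum_beta hD hr hm he
    (K := fun u v => (corrMass (lift C))⁻¹ * corr (lift C) (lift C) u v)
    (y := corrVal (lift C)) (fun u v _ => by rw [corrVal_card, div_eq_inv_mul])
    (fun u v => by rw [corr_compl_left compl_mem_lift])
    (fun u v => by rw [corr_compl_right compl_mem_lift])
    (corr_posSemidef.smul (inv_nonneg.2 corrMass_nonneg))
  convert h using 1
  ext i j
  simp only [block, Matrix.of_apply]
  refine sum_congr rfl fun t ht => ?_
  rw [codePoint_val (mem_admissible.1 ht)]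

/-- `ζ` is the smaller of the sizes of `u ∆ v` and its complement, which have equal correlation with
`∅`. -/
lemma corrVal_zeta (C : Finset (Vertex (2 * D))) (u v : Finset (Fin (2 * D))) :
    corrVal (lift C) (zeta D #u #v #(u ∩ v)) 0 0 =
      corr (lift C) (lift C) (u ∆ v) ∅ / corrMass (lift C) := by
  rw [zeta, card_symmDiff_eq]
  have hcard : 2 * D - #(u ∆ v) = #(u ∆ v)ᶜ := by rw [card_compl, Fintype.card_fin]
  rcases le_total #(u ∆ v) (2 * D - #(u ∆ v)) with h | h
  · rw [min_eq_left h, corrVal_card_empty]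
  · rw [min_eq_right h, hcard, corrVal_card_empty, corr_compl_left compl_mem_lift]

/-- The kernel here has its centres outside `lift C`: it equals the kernel over all centres, which
gives `x^0_{ζ,0}`, minus the one with centres in `lift C`. -/
lemma coblock_codePoint_posSemidef (hD : 3 ≤ D) {r m : ℕ} (hr : r < D) (hm : m ≤ D)
    (he : Even r ∨ m < D) (C : Finset (Vertex (2 * D))) :
    (coblock D r m (codePoint C)).PosSemidef := by
  have h := posSemidef_sum_beta hD hr hm he
    (K := fun u v => (corrMass (lift C))⁻¹ * corr (lift C) (lift C)ᶜ u v)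
    (y := fun i j t => corrVal (lift C) (zeta D i j t) 0 0 - corrVal (lift C) i j t)
    (fun u v _ => by
      rw [corrVal_card, corrVal_zeta, ← corr_univ, ← corr_add_corr_compl (E := lift C)]
      ring)
    (fun u v => by rw [corr_compl_left compl_mem_lift])
    (fun u v => by rw [corr_compl_right compl_mem_lift])
    (corr_posSemidef.smul (inv_nonneg.2 corrMass_nonneg))
  convert h using 1
  ext i j
  simp only [coblock, Matrix.of_apply]
  refine sum_congr rfl fun t ht => ?_
  rw [codePoint_val (mem_admissible.1 ht), codePoint_val (mem_index_zero hD _)]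
  unfold zeta
  omega

lemma feasible_codePoint (hD : 3 ≤ D) (hd : d ≤ 2 * D) {C : Finset (Vertex (2 * D))}
    (hC : IsCode (graph (2 * D)) d C) : Feasible D d (codePoint C) where
  toLinearConstraints := linearConstraints_codePoint hD hd hC
  block_even := fun _ he hr =>
    block_codePoint_posSemidef hD (by omega) le_rfl (Or.inl he) C
  block_odd := fun _ _ hr =>
    block_codePoint_posSemidef hD (by omega) (Nat.sub_le _ _) (Or.inr (by omega)) C
  coblock_even := fun _ he hr =>
    coblock_codePoint_posSemidef hD (by omega) le_rfl (Or.inl he) C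
  coblock_odd := fun _ _ hr =>
    coblock_codePoint_posSemidef hD (by omega) (Nat.sub_le _ _) (Or.inr (by omega)) C

/-- The sum over all sizes is `2 * #C`. It is symmetric under `i ↦ 2D - i`, so half of it is the sum
below `D` plus half the middle term. -/
lemma objective_codePoint (hD : 3 ≤ D) {C : Finset (Vertex (2 * D))} (hC : C.Nonempty) :
    objective D (codePoint C) = #C := by
  have h := sum_corrVal (lift_nonempty hC)
  rw [card_lift (by omega), Fintype.card_fin] at h
  have hsym : ∀ i ≤ 2 * D, corrVal (lift C) (2 * D - i) 0 0 = corrVal (lift C) i 0 0 := by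
    intro i hi
    obtain ⟨u, -, rfl⟩ := exists_subset_card_eq (s := (univ : Finset (Fin (2 * D)))) (n := i)
      (by simpa using hi)
    rw [show 2 * D - #u = #uᶜ by rw [card_compl, Fintype.card_fin], corrVal_card_empty,
      corrVal_card_empty, corr_compl_left compl_mem_lift]
  have hupper : ∑ i ∈ Ico (D + 1) (2 * D + 1), ((2 * D).choose i : ℝ) * corrVal (lift C) i 0 0 =
      ∑ i ∈ range D, ((2 * D).choose i : ℝ) * corrVal (lift C) i 0 0 := by
    refine sum_nbij' (fun i => 2 * D - i) (fun i => 2 * D - i) ?_ ?_ ?_ ?_ ?_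
    · intro i hi; simp only [mem_Ico, mem_range] at *; omega
    · intro i hi; simp only [mem_Ico, mem_range] at *; omega
    · intro i hi; simp only [mem_Ico] at *; omega
    · intro i hi; simp only [mem_range] at *; omega
    · intro i hi
      have hi : i ≤ 2 * D := by simp only [mem_Ico] at hi; omega
      rw [hsym i hi, Nat.choose_symm hi]
  rw [← sum_range_add_sum_Ico _ (show D + 1 ≤ 2 * D + 1 by omega), sum_range_succ, hupper] at h
  have hval : ∀ i ≤ D, (codePoint C).val i 0 0 = corrVal (lift C) i 0 0 := fun i hi =>
    codePoint_val (mem_index_zero hD hi)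
  rw [objective, hval D le_rfl, sum_congr rfl fun i hi => by rw [hval i (mem_range.1 hi).le]]
  push_cast at h
  linarith

lemma exists_code_card_eq {V : Type*} [Finite V] [Nonempty V] (G : SimpleGraph V) (d : ℕ) :
    ∃ C : Finset V, IsCode G d C ∧ #C = codeNumber G d := by
  have := Fintype.ofFinite V
  refine Nat.sSup_mem (s := {m : ℕ | ∃ C : Finset V, IsCode G d C ∧ C.card = m}) ?_ ?_
  · obtain ⟨v⟩ := ‹Nonempty V›
    refine ⟨1, {v}, ⟨singleton_nonempty v, fun x hx y hy hxy => ?_⟩, card_singleton v⟩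
    exact absurd ((mem_singleton.1 hx).trans (mem_singleton.1 hy).symm) hxy
  · refine ⟨Fintype.card V, ?_⟩
    rintro _ ⟨C, -, rfl⟩
    exact card_le_univ C

end FoldedCube

theorem mainTheorem2 (D d : ℕ) (hD : 3 ≤ D) (hodd : Odd D) (hd : d ≤ 2 * D) :
    ∃ v : ℝ, IsGreatest (FoldedCube.objective D '' {x | FoldedCube.Feasible D d x}) v ∧
      (FoldedCube.codeNumber (FoldedCube.graph (2 * D)) d : ℝ) ≤ v := by
  have : Nonempty (FoldedCube.Vertex (2 * D)) := ⟨FoldedCube.toVertex ∅⟩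
  obtain ⟨C, hC, hcard⟩ := FoldedCube.exists_code_card_eq (FoldedCube.graph (2 * D)) d
  have hx := FoldedCube.feasible_codePoint hD hd hC
  obtain ⟨x, hx', hmax⟩ := (FoldedCube.isCompact_feasible (by omega) d).exists_isMaxOn ⟨_, hx⟩
    (FoldedCube.continuous_objective D).continuousOn
  refine ⟨FoldedCube.objective D x, ⟨⟨x, hx', rfl⟩, ?_⟩, ?_⟩
  · rintro _ ⟨y, hy, rfl⟩
    exact hmax hy
  · rw [← hcard, ← FoldedCube.objective_codePoint hD hC.1]
    exact hmax hx
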